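/- Let $F:\mathbb{D}\to\mathbb{D}$ be a centered inner function other than a rotation: $F$ is holomorphic, $F(0)=0$, the radial boundary values of $F$ exist and have absolute value $1$ at almost every point of $S^1=\partial\mathbb{D}$. Let $m$ be the normalized Lebesgue measure on $S^1$. Suppose that $F$ has finite Lyapunov exponent, i.e. for $m$-a.e. $\zeta\in S^1$ the angular derivative $F'(\zeta)=\lim_{r\to1^-}F'(r\zeta)$ exists and is finite, and $\int_{S^1}\log|F'|\,dm<\infty$. Let $\widehat{\mathbb{D}}$ be the space of backward orbits $\mathbf z=(z_{-n})_{n\ge0}$ in $\mathbb{D}$, $F(z_{-n-1})=z_{-n}$, other than the constant orbit $0$, with the Borel $\sigma$-algebra of the product topology. Let $\widehat F:\widehat{\mathbb{D}}\to\widehat{\mathbb{D}}$ be the bijection applying $F$ to each coordinate, and let $\widehat X=\widehat{\mathbb{D}}/\widehat F$ be the lamination (the space of orbits of the group generated by $\widehat F$). For $A\subset\mathbb{D}$ let $\widehat A=\{\mathbf z\in\widehat{\mathbb{D}}: z_0\in A\}$, and let $dA_{\mathrm{hyp}}=\frac{4\,dx\,dy}{(1-|z|^2)^2}$. (a) There is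 a unique $\widehat F$-invariant measure $\xi$ on $\widehat{\mathbb{D}}$ such that, for every measurable set $A$ compactly contained in $\mathbb{D}$, $$\xi(\widehat A)=\lim_{n\to\infty}\frac1{2\pi}\int_{F^{-n}(A)}\log\frac1{|z|}\,dA_{\mathrm{hyp}}(z)\in[0,\infty],$$ where the limit exists in $[0,\infty]$; it is finite if $A$ is compactly contained in $\mathbb{D}\setminus\{0\}$. (b) There is a unique measure on $\widehat X$, again denoted $\xi$, that assigns to the image in $\widehat X$ of each measurable set $E\subset\widehat{\mathbb{D}}$ on which the projection $\widehat{\mathbb{D}}\to\widehat X$ is injective the mass $\xi(E)$. It is finite, and its total mass is the Lyapunov exponent of $F$: $$\xi(\widehat X)=\int_{S^1}\log|F'|\,dm .$$ -/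

import Mathlib

open MeasureTheory Filter Topology Set Metric

noncomputable section

/-- A centered inner function: a holomorphic self-map `F` of the open unit disk with `F 0 = 0`, whose
radial boundary values exist and have absolute value `1` at almost every point of the unit circle.
(The values of `toFun` outside the open unit disk play no role.) -/
structure CenteredInnerFunction where
  toFun : ℂ → ℂ
  differentiableOn : DifferentiableOn ℂ toFun (ball 0 1)
  mapsTo : MapsTo toFun (ball 0 1) (ball 0 1)
  ae_radial_limit : ∀ᵐ θ : ℝ, ∃ η : ℂ, ‖η‖ = 1 ∧
    Tendsto (fun r : ℝ => toFun (r * circleMap 0 1 θ)) (𝓝[<] 1) (𝓝 η)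
  map_zero : toFun 0 = 0

namespace CenteredInnerFunction

instance : CoeFun CenteredInnerFunction (fun _ => ℂ → ℂ) := ⟨toFun⟩

/-- `F` is a rotation of the unit disk. -/
def IsRotation (F : CenteredInnerFunction) : Prop :=
  ∃ c : ℂ, ‖c‖ = 1 ∧ ∀ z ∈ ball (0 : ℂ) 1, F z = c * z

/-- `F` has an angular derivative at the point `ζ` of the unit circle: the radial limit of `F` at `ζ`
exists and is unimodular, and the radial limit of `F'` at `ζ` exists (and is finite). -/
def HasAngularDerivative (F : CenteredInnerFunction) (ζ : ℂ) : Prop :=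
  (∃ η : ℂ, ‖η‖ = 1 ∧ Tendsto (fun r : ℝ => F (r * ζ)) (𝓝[<] 1) (𝓝 η)) ∧
  ∃ d : ℂ, Tendsto (fun r : ℝ => deriv F (r * ζ)) (𝓝[<] 1) (𝓝 d)

/-- The angular derivative `F'(ζ) = lim_{r → 1} F'(r ζ)` (meaningful where it exists). -/
def angularDerivative (F : CenteredInnerFunction) (ζ : ℂ) : ℂ :=
  limUnder (𝓝[<] (1 : ℝ)) (fun r : ℝ => deriv F (r * ζ))

/-- `F` has finite Lyapunov exponent: the angular derivative exists almost everywhere on the unit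
circle and `log |F'|` is integrable. -/
def FiniteLyapunovExponent (F : CenteredInnerFunction) : Prop :=
  (∀ᵐ θ : ℝ, F.HasAngularDerivative (circleMap 0 1 θ)) ∧
  CircleIntegrable (fun ζ => Real.log ‖F.angularDerivative ζ‖) 0 1

/-- The Lyapunov exponent `∫ log |F'| dm`, where `m` is normalized Lebesgue measure on the circle. -/
def lyapunovExponent (F : CenteredInnerFunction) : ℝ :=
  Real.circleAverage (fun ζ => Real.log ‖F.angularDerivative ζ‖) 0 1

/-- The space of backward orbits `⋯ → z 2 → z 1 → z 0` of `F` in the unit disk (`z n` stands for the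
coordinate of index `-n`), without the constant orbit `0`. It carries the product topology and the
product (equivalently, Borel) `σ`-algebra. -/
abbrev BackwardOrbit (F : CenteredInnerFunction) : Type :=
  {z : ℕ → ℂ // (∀ n, z n ∈ ball (0 : ℂ) 1) ∧ (∀ n, F (z (n + 1)) = z n) ∧ z ≠ 0}

/-- The bijection of the space of backward orbits that applies `F` to each coordinate. Its inverse is
the shift. -/
def hat (F : CenteredInnerFunction) : Equiv.Perm F.BackwardOrbit where
  toFun z := ⟨fun n => F (z.1 n), fun n => F.mapsTo (z.2.1 n), fun n => congrArg F.toFun (z.2.2.1 n),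
    fun h => z.2.2.2 (by
      funext n
      have h1 := congrFun h (n + 1)
      exact (z.2.2.1 n).symm.trans h1)⟩
  invFun z := ⟨fun n => z.1 (n + 1), fun n => z.2.1 (n + 1), fun n => z.2.2.1 (n + 1),
    fun h => z.2.2.2 (by
      have h1 : ∀ n, z.1 (n + 1) = 0 := fun n => congrFun h n
      funext n
      rw [← z.2.2.1 n, h1 n, F.map_zero]
      rfl)⟩
  left_inv z := by
    apply Subtype.ext
    funext n
    exact z.2.2.1 n
  right_inv z := by
    apply Subtype.ext
    funext n
    exact z.2.2.1 n

/-- The lamination: the quotient of the space of backward orbits by the action of the cyclic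
group generated by `F.hat`, with the quotient `σ`-algebra. -/
abbrev Lamination (F : CenteredInnerFunction) : Type :=
  MulAction.orbitRel.Quotient (Subgroup.zpowers F.hat) F.BackwardOrbit

/-- The quotient map onto the lamination. -/
def proj (F : CenteredInnerFunction) (z : F.BackwardOrbit) : F.Lamination :=
  Quotient.mk _ z

/-- The set of backward orbits `z` whose last point `z 0` lies in `A`. -/
def cylinder (F : CenteredInnerFunction) (A : Set ℂ) : Set F.BackwardOrbit :=
  {z | z.1 0 ∈ A}

/-- The preimage of `A` under the `n`-th iterate of `F : 𝔻 → 𝔻`. -/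
def iterPreimage (F : CenteredInnerFunction) (n : ℕ) (A : Set ℂ) : Set ℂ :=
  {z ∈ ball (0 : ℂ) 1 | F^[n] z ∈ A}

end CenteredInnerFunction

/-- Hyperbolic area on the unit disk, for the metric `2 |dz| / (1 - |z|²)` of curvature `-1`. -/
def hyperbolicArea : Measure ℂ :=
  (volume.restrict (ball (0 : ℂ) 1)).withDensity
    (fun z => ENNReal.ofReal (4 / (1 - ‖z‖ ^ 2) ^ 2))

/-- `(1 / 2π) ∫_E log (1 / |z|) dA_hyp`, as an element of `[0, ∞]`. -/
def heightArea (E : Set ℂ) : ENNReal :=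
  ENNReal.ofReal (1 / (2 * Real.pi)) *
    ∫⁻ z in E, ENNReal.ofReal (Real.log (1 / ‖z‖)) ∂hyperbolicArea

namespace CenteredInnerFunction

/-- `ξ` is a natural measure on the space of backward orbits: it is invariant under `F.hat`, and for
every measurable set `A` compactly contained in the unit disk, `ξ` of the set of backward orbits that
end in `A` is the limit, in `[0, ∞]`, of `(1 / 2π) ∫_{F^{-n}(A)} log (1 / |z|) dA_hyp`. -/
structure IsNaturalMeasure (F : CenteredInnerFunction) (ξ : Measure F.BackwardOrbit) : Prop where
  invariant : MeasurePreserving F.hat ξ ξ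
  tendsto : ∀ A : Set ℂ, MeasurableSet A → closure A ⊆ ball 0 1 →
    Tendsto (fun n : ℕ => heightArea (F.iterPreimage n A)) atTop (𝓝 (ξ (F.cylinder A)))

/-- `ν` is the measure induced by `ξ` on the lamination: `ν (proj E) = ξ E` for each measurable set
`E` of backward orbits on which the quotient map is injective. -/
def IsInducedMeasure (F : CenteredInnerFunction) (ξ : Measure F.BackwardOrbit)
    (ν : Measure F.Lamination) : Prop :=
  ∀ E : Set F.BackwardOrbit, MeasurableSet E → InjOn F.proj E → ν (F.proj '' E) = ξ E

end CenteredInnerFunction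

end

/-! Let λ be the measure (1/2π) log(1/|z|) dA_hyp on the disk (`heightMeasure`). By Schwarz–Pick, λ
is the sum of its analogue for the metric pulled back by F and a nonnegative defect δ
(`defectMeasure`). The image of log(1/|z|)|F'|² dx dy under a centered inner F is the same for every
F (`IsCenteredInnerMap.map_greenMeasure_eq`). Comparison with the identity gives F_*λ = λ + F_*δ.
Hence (F^n)_*λ increases to μ = λ + Σ (F^{n+1})_*δ, which is F-invariant and is the limit in the
theorem.

The Littlewood–Paley identity turns the mass of δ into a limit of circle averages of
log((1-|F|²)/(1-|z|²)). This quotient increases along each radius to |F'|, so δ has total mass ∫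
log|F'| dm.

A disk B of radius r < 1 about 0 satisfies B ⊆ F⁻¹(B), and F⁻¹(B) \ B has (F^n)_*λ-mass
δ(F^{-(n+1)}B). Since F is not a rotation, all orbits tend to 0, so in the limit its μ-mass is δ(𝔻).
Finitely many preimages of this set cover any compact part of the punctured disk, so μ is finite
there. This permits building the natural extension ξ as a sum of inverse limits of finite measures
(`exists_naturalExtension`). The backward orbits that enter B at time 0 form a fundamental domain
for the shift, and its ξ-mass is μ(F⁻¹(B) \ B) = δ(𝔻), the Lyapunov exponent. -/

/-! ### Power series and Parseval's identity on circles -/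

/-- The `n`-th Taylor coefficient of `f` at the origin. -/
noncomputable def taylorCoeffZero (f : ℂ → ℂ) (n : ℕ) : ℂ := (n.factorial : ℂ)⁻¹ * iteratedDeriv n f 0

/-- The Lebesgue integral of `g` over the circle of radius `r`, of total mass `2π`. -/
noncomputable def circleLIntegral (g : ℂ → ENNReal) (r : ℝ) : ENNReal :=
  ∫⁻ θ in Ioo (-Real.pi) Real.pi, g (circleMap 0 r θ)

theorem hasSum_taylorCoeffZero {f : ℂ → ℂ} (hf : DifferentiableOn ℂ f (ball 0 1)) {z : ℂ}
    (hz : ‖z‖ < 1) : HasSum (fun n => taylorCoeffZero f n * z ^ n) (f z) := by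
  have := Complex.hasSum_taylorSeries_on_ball hf (z := z) (by simpa using hz)
  simpa [taylorCoeffZero, mul_comm, mul_left_comm] using this

theorem taylorCoeffZero_deriv (f : ℂ → ℂ) (n : ℕ) :
    taylorCoeffZero (deriv f) n = (n + 1) * taylorCoeffZero f (n + 1) := by
  have h : ((n : ℂ) + 1) ≠ 0 := by exact_mod_cast n.succ_ne_zero
  simp only [taylorCoeffZero, iteratedDeriv_succ', Nat.factorial_succ]
  push_cast
  field_simp

theorem taylorCoeffZero_zero (f : ℂ → ℂ) : taylorCoeffZero f 0 = f 0 := by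
  simp [taylorCoeffZero]

theorem sum_range_sq_norm_eq_circleAverage (a : ℕ → ℂ) (N : ℕ) :
    ∑ n ∈ Finset.range N, ‖a n‖ ^ 2 =
      Real.circleAverage (fun z => ‖∑ n ∈ Finset.range N, a n * z ^ n‖ ^ 2) 0 1 := by
  have h := Polynomial.sum_sq_norm_coeff_eq_circleAverage
    (∑ n ∈ Finset.range N, Polynomial.monomial n (a n))
  simp only [Polynomial.eval_finsetSum, Polynomial.eval_monomial] at h
  rw [← h]
  have hc : ∀ i, (∑ n ∈ Finset.range N, Polynomial.monomial n (a n)).coeff i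
      = if i < N then a i else 0 := by
    intro i
    simp [Polynomial.coeff_monomial]
  symm
  -- The polynomial identity sums over the support, which is smaller than `range N` when some `a n`
  -- vanish.
  rw [Finset.sum_subset (s₂ := Finset.range N)]
  · refine Finset.sum_congr rfl fun i hi => ?_
    rw [hc, if_pos (Finset.mem_range.1 hi)]
  · intro i hi
    rw [Polynomial.mem_support_iff, hc] at hi
    by_contra hcon
    exact hi (if_neg (by simpa using hcon))
  · intro i _ hi
    rw [Polynomial.notMem_support_iff.1 hi]
    simp

/-- **Parseval's identity** on circles centered at the origin. -/
theorem hasSum_sq_taylorCoeffZero {f : ℂ → ℂ} (hf : DifferentiableOn ℂ f (ball 0 1)) {r : ℝ}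
    (hr : 0 ≤ r) (hr1 : r < 1) :
    HasSum (fun n => ‖taylorCoeffZero f n‖ ^ 2 * (r ^ 2) ^ n)
      (Real.circleAverage (fun z => ‖f z‖ ^ 2) 0 r) := by
  set a : ℕ → ℂ := fun n => taylorCoeffZero f n * (r : ℂ) ^ n with ha
  have hnorm : ∀ n, ‖a n‖ ^ 2 = ‖taylorCoeffZero f n‖ ^ 2 * (r ^ 2) ^ n := by
    intro n
    rw [ha]
    simp only [norm_mul, norm_pow, Complex.norm_real, Real.norm_eq_abs, abs_of_nonneg hr]
    ring
  have hsum : Summable fun n => ‖a n‖ :=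
    (hasSum_taylorCoeffZero hf (z := (r : ℂ)) (by simpa [abs_of_nonneg hr])).summable.norm
  simp_rw [← hnorm]
  rw [hasSum_iff_tendsto_nat_of_nonneg (fun n => by positivity)]
  simp_rw [sum_range_sq_norm_eq_circleAverage]
  rw [Real.circleAverage_eq_circleAverage_zero_one]
  simp only [Real.circleAverage, add_zero]
  refine Tendsto.const_smul ?_ _
  refine intervalIntegral.tendsto_integral_filter_of_dominated_convergence
    (fun _ => (∑' n, ‖a n‖) ^ 2) ?_ ?_ ?_ ?_
  · refine Eventually.of_forall fun N => Continuous.aestronglyMeasurable ?_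
    fun_prop
  · refine Eventually.of_forall fun N => Eventually.of_forall fun θ _ => ?_
    rw [norm_pow, norm_norm]
    gcongr
    refine (norm_sum_le _ _).trans ?_
    refine le_trans (le_of_eq ?_) (hsum.sum_le_tsum (Finset.range N) (fun _ _ => norm_nonneg _))
    refine Finset.sum_congr rfl fun i _ => ?_
    simp
  · exact intervalIntegrable_const
  · refine Eventually.of_forall fun θ _ => ?_
    have h1 := hasSum_taylorCoeffZero hf (z := r * circleMap 0 1 θ)
      (by simpa [abs_of_nonneg hr] using hr1)
    have h2 := h1.tendsto_sum_nat
    refine ((h2.congr fun N => Finset.sum_congr rfl fun n _ => ?_).norm).pow 2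
    simp only [ha]
    rw [mul_pow]; ring

/-- Polar coordinates use the angles (-π, π) and circle averages use (0, 2π); periodicity reconciles
the two. -/
theorem circleLIntegral_ofReal {g : ℂ → ℝ} {r : ℝ} (hg : CircleIntegrable g 0 r)
    (h0 : ∀ᵐ θ : ℝ, 0 ≤ g (circleMap 0 r θ)) :
    circleLIntegral (fun z => ENNReal.ofReal (g z)) r =
      ENNReal.ofReal (2 * Real.pi * Real.circleAverage g 0 r) := by
  have hper : Function.Periodic (fun θ => g (circleMap 0 r θ)) (2 * Real.pi) := fun θ => by
    simp only [periodic_circleMap 0 r θ]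
  have hi : IntervalIntegrable (fun θ => g (circleMap 0 r θ)) volume (-Real.pi) Real.pi := by
    refine hper.intervalIntegrable (t := 0) (by positivity) ?_ _ _
    rw [zero_add]
    exact hg
  have hint : ∫ θ in (-Real.pi)..Real.pi, g (circleMap 0 r θ)
      = 2 * Real.pi * Real.circleAverage g 0 r := by
    have := hper.intervalIntegral_add_eq (-Real.pi) 0
    rw [show -Real.pi + 2 * Real.pi = Real.pi by ring, zero_add] at this
    rw [this, Real.circleAverage, smul_eq_mul]
    field_simp
  rw [circleLIntegral, ← hint, intervalIntegral.integral_of_le (by linarith [Real.pi_pos]),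
    integral_Ioc_eq_integral_Ioo,
    ofReal_integral_eq_lintegral_ofReal]
  · rw [intervalIntegrable_iff_integrableOn_Ioo_of_le (by linarith [Real.pi_pos])] at hi
    exact hi
  · exact ae_restrict_of_ae h0

theorem circleLIntegral_enorm_sq {f : ℂ → ℂ} {r : ℝ} (hf : ContinuousOn f (sphere 0 |r|)) :
    circleLIntegral (fun z => ‖f z‖ₑ ^ 2) r =
      ENNReal.ofReal (2 * Real.pi * Real.circleAverage (fun z => ‖f z‖ ^ 2) 0 r) := by
  have hc : ContinuousOn (fun z => ‖f z‖ ^ 2) (sphere 0 |r|) := hf.norm.pow 2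
  rw [← circleLIntegral_ofReal hc.circleIntegrable'
    (Eventually.of_forall fun θ => by positivity)]
  congr 1
  funext z
  rw [ENNReal.ofReal_pow (norm_nonneg _), ofReal_norm]

theorem continuousOn_sphere_of_differentiableOn {f : ℂ → ℂ} (hf : DifferentiableOn ℂ f (ball 0 1))
    {r : ℝ} (hr : 0 ≤ r) (hr1 : r < 1) : ContinuousOn f (sphere 0 |r|) := by
  refine hf.continuousOn.mono fun z hz => ?_
  rw [abs_of_nonneg hr, mem_sphere_zero_iff_norm] at hz
  rw [mem_ball_zero_iff, hz]
  exact hr1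

theorem circleLIntegral_enorm_sq_eq_tsum {f : ℂ → ℂ} (hf : DifferentiableOn ℂ f (ball 0 1)) {r : ℝ}
    (hr : 0 ≤ r) (hr1 : r < 1) :
    circleLIntegral (fun z => ‖f z‖ₑ ^ 2) r =
      ∑' n, ENNReal.ofReal (2 * Real.pi * (‖taylorCoeffZero f n‖ ^ 2 * (r ^ 2) ^ n)) := by
  have h := (hasSum_sq_taylorCoeffZero hf hr hr1).mul_left (2 * Real.pi)
  rw [circleLIntegral_enorm_sq (continuousOn_sphere_of_differentiableOn hf hr hr1),
    ← ENNReal.ofReal_tsum_of_nonneg (fun n => by positivity) h.summable, h.tsum_eq]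

/-! ### The Littlewood–Paley identity -/

/-- The Green function `log (R / |z|)` of the disk of radius `R` with pole at the origin, extended
by zero outside the disk. -/
noncomputable def greenWeight (R : ℝ) (z : ℂ) : ENNReal := ENNReal.ofReal (Real.log (R / ‖z‖))

theorem measurable_greenWeight (R : ℝ) : Measurable (greenWeight R) := by
  unfold greenWeight
  fun_prop

theorem greenWeight_eq_zero {R : ℝ} (hR : 0 < R) {z : ℂ} (hz : R ≤ ‖z‖) : greenWeight R z = 0 := by
  rw [greenWeight, ENNReal.ofReal_eq_zero]
  exact Real.log_nonpos (by positivity) (div_le_one_of_le₀ hz (by positivity))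

/-- Polar coordinates. The weight vanishes outside the disk of radius R, so the integral may first
be extended to the whole plane. -/
theorem lintegral_greenWeight_mul {g : ℂ → ENNReal} (hg : Measurable g) {R : ℝ} (hR : 0 < R)
    (hR1 : R ≤ 1) :
    ∫⁻ z in ball 0 1, greenWeight R z * g z =
      ∫⁻ r in Ioo 0 R, ENNReal.ofReal (r * Real.log (R / r)) * circleLIntegral g r := by
  have h1 : ∫⁻ z in ball 0 1, greenWeight R z * g z = ∫⁻ z, greenWeight R z * g z := by
    rw [← lintegral_indicator measurableSet_ball]
    refine lintegral_congr fun z => ?_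
    by_cases hz : z ∈ ball (0 : ℂ) 1
    · rw [indicator_of_mem hz]
    · rw [indicator_of_notMem hz, greenWeight_eq_zero hR, zero_mul]
      simp only [mem_ball_zero_iff, not_lt] at hz
      linarith
  have hpt : ∀ p : ℝ × ℝ, Complex.polarCoord.symm p = circleMap 0 p.1 p.2 := by
    intro p
    rw [Complex.polarCoord_symm_apply, circleMap_zero, Complex.exp_mul_I]
    push_cast
    rfl
  have hmeas : Measurable fun p : ℝ × ℝ => g (circleMap 0 p.1 p.2) := by
    refine hg.comp ?_
    unfold circleMap
    fun_prop
  rw [h1, ← Complex.lintegral_comp_polarCoord_symm]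
  have htarget : polarCoord.target = Ioi (0 : ℝ) ×ˢ Ioo (-Real.pi) Real.pi := rfl
  rw [htarget, Measure.volume_eq_prod, ← Measure.prod_restrict, lintegral_prod]
  · rw [← lintegral_indicator measurableSet_Ioi, ← lintegral_indicator measurableSet_Ioo]
    refine lintegral_congr fun r => ?_
    by_cases hr : r ∈ Ioi (0 : ℝ)
    · rw [indicator_of_mem hr]
      have hr' : (0 : ℝ) < r := hr
      have hn : ∀ θ, ‖circleMap 0 r θ‖ = r := fun θ => by simp [abs_of_pos hr']
      by_cases hrR : r < R
      · rw [indicator_of_mem (show r ∈ Ioo 0 R from ⟨hr', hrR⟩), circleLIntegral,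
          ← lintegral_const_mul]
        · refine lintegral_congr fun θ => ?_
          rw [hpt, smul_eq_mul, greenWeight, hn, ENNReal.ofReal_mul hr'.le, mul_assoc]
        · exact hmeas.comp (measurable_const.prodMk measurable_id)
      · rw [indicator_of_notMem (fun h => hrR h.2)]
        simp_rw [hpt]
        simp [greenWeight_eq_zero hR (z := circleMap 0 r _) ((hn _).symm ▸ not_lt.1 hrR)]
    · rw [indicator_of_notMem hr, indicator_of_notMem (fun h => hr h.1)]
  · simp_rw [hpt, smul_eq_mul]
    refine Measurable.aemeasurable ?_
    refine (ENNReal.measurable_ofReal.comp measurable_fst).mul (Measurable.mul ?_ hmeas)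
    refine (measurable_greenWeight R).comp ?_
    unfold circleMap
    fun_prop

theorem lintegral_mul_log_mul_pow {R : ℝ} (hR : 0 < R) (n : ℕ) :
    ∫⁻ r in Ioo 0 R, ENNReal.ofReal (r * Real.log (R / r) * (r ^ 2) ^ n) =
      ENNReal.ofReal (R ^ (2 * n + 2) / (2 * n + 2) ^ 2) := by
  -- An antiderivative, r^{2n+2} log(R/r)/(2n+2) + r^{2n+2}/(2n+2)², written through r log r so that
  -- continuity at 0 is visible.
  set G : ℝ → ℝ := fun r => (r ^ (2 * n + 2) * Real.log R - r ^ (2 * n + 1) * (r * Real.log r)) /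
    (2 * n + 2) + r ^ (2 * n + 2) / (2 * n + 2) ^ 2 with hG
  have hn : (2 * (n : ℝ) + 2) ≠ 0 := by positivity
  have hcont : ContinuousOn G (Icc 0 R) := by
    have : Continuous fun r : ℝ => r * Real.log r := Real.continuous_mul_log
    refine Continuous.continuousOn ?_
    rw [hG]
    fun_prop
  have hder : ∀ r ∈ Ioo 0 R, HasDerivAt G (r * Real.log (R / r) * (r ^ 2) ^ n) r := by
    intro r hr
    have h1 : HasDerivAt (fun r : ℝ => r ^ (2 * n + 2)) ((2 * n + 2) * r ^ (2 * n + 1)) r := by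
      simpa using hasDerivAt_pow (2 * n + 2) r
    have h3 : HasDerivAt (fun r : ℝ => r ^ (2 * n + 2) * Real.log r)
        ((2 * n + 2) * r ^ (2 * n + 1) * Real.log r + r ^ (2 * n + 2) * r⁻¹) r :=
      h1.mul (Real.hasDerivAt_log hr.1.ne')
    have h2 := (((h1.mul_const (Real.log R)).sub h3).div_const (2 * n + 2)).add
      (h1.div_const ((2 * n + 2) ^ 2))
    have hr0 := hr.1.ne'
    refine (h2.congr_of_eventuallyEq (Eventually.of_forall fun x => ?_)).congr_deriv ?_
    · simp only [hG, Pi.add_apply, Pi.sub_apply]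
      ring
    · rw [Real.log_div hR.ne' hr0]
      field_simp
      ring
  have hnonneg : ∀ r ∈ Ioo 0 R, 0 ≤ r * Real.log (R / r) * (r ^ 2) ^ n := by
    intro r hr
    have h0 := hr.1
    have := Real.log_nonneg ((one_le_div h0).2 hr.2.le)
    positivity
  have hint := intervalIntegral.integrableOn_deriv_of_nonneg hcont hder hnonneg
  have hval := intervalIntegral.integral_eq_sub_of_hasDerivAt_of_le hR.le hcont hder
    ((intervalIntegrable_iff_integrableOn_Ioc_of_le hR.le).2 hint)
  rw [← ofReal_integral_eq_lintegral_ofReal (hint.mono_set Ioo_subset_Ioc_self)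
    ((ae_restrict_iff' measurableSet_Ioo).2 (Eventually.of_forall hnonneg)),
    ← integral_Ioc_eq_integral_Ioo, ← intervalIntegral.integral_of_le hR.le, hval]
  congr 1
  simp only [hG]
  rw [zero_pow (by lia), zero_pow (by lia)]
  ring

/-- The **Littlewood–Paley identity** on a disk centered at the origin. -/
theorem littlewoodPaley {h : ℂ → ℂ} (hh : DifferentiableOn ℂ h (ball 0 1)) (h0 : h 0 = 0) {R : ℝ}
    (hR : 0 < R) (hR1 : R < 1) :
    4 * ∫⁻ z in ball 0 1, greenWeight R z * ‖deriv h z‖ₑ ^ 2 =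
      circleLIntegral (fun z => ‖h z‖ₑ ^ 2) R := by
  -- Both sides become power series in R². The constant term on the right drops out because h(0) =
  -- 0, and the other terms match because 4(n+1)²/(2n+2)² = 1.
  rw [lintegral_greenWeight_mul ((measurable_deriv h).enorm.pow_const 2) hR hR1.le,
    circleLIntegral_enorm_sq_eq_tsum hh hR.le hR1, tsum_eq_zero_add' ENNReal.summable,
    taylorCoeffZero_zero, h0]
  have hd : DifferentiableOn ℂ (deriv h) (ball 0 1) := hh.deriv isOpen_ball
  have h1 : ∀ r ∈ Ioo 0 R, ENNReal.ofReal (r * Real.log (R / r)) *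
      circleLIntegral (fun z => ‖deriv h z‖ₑ ^ 2) r = ∑' n : ℕ,
        ENNReal.ofReal (2 * Real.pi * ((n + 1) ^ 2 * ‖taylorCoeffZero h (n + 1)‖ ^ 2)) *
          ENNReal.ofReal (r * Real.log (R / r) * (r ^ 2) ^ n) := by
    intro r hr
    have hr0 := hr.1
    have hlog := Real.log_nonneg ((one_le_div hr0).2 hr.2.le)
    rw [circleLIntegral_enorm_sq_eq_tsum hd hr.1.le (hr.2.trans hR1), ← ENNReal.tsum_mul_left]
    refine tsum_congr fun n => ?_
    rw [← ENNReal.ofReal_mul (by positivity), ← ENNReal.ofReal_mul (by positivity)]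
    congr 1
    rw [taylorCoeffZero_deriv, norm_mul]
    have : ‖(n : ℂ) + 1‖ = n + 1 := by
      rw [← Nat.cast_one, ← Nat.cast_add, Complex.norm_natCast]
      push_cast; rfl
    rw [this]
    ring
  rw [setLIntegral_congr_fun measurableSet_Ioo h1, lintegral_tsum, ← ENNReal.tsum_mul_left]
  · simp only [norm_zero, ne_eq, OfNat.ofNat_ne_zero, not_false_eq_true, zero_pow, zero_mul,
      mul_zero, ENNReal.ofReal_zero, zero_add]
    refine tsum_congr fun n => ?_
    rw [lintegral_const_mul _ (by fun_prop), lintegral_mul_log_mul_pow hR,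
      ← ENNReal.ofReal_mul (by positivity), show (4 : ENNReal) = ENNReal.ofReal 4 by simp,
      ← ENNReal.ofReal_mul (by positivity)]
    congr 1
    have : (2 * (n : ℝ) + 2) ≠ 0 := by positivity
    field_simp
    ring
  · intro n
    fun_prop

/-! ### Schwarz–Pick and the potential of the pulled-back hyperbolic metric -/

/-- A measurable map `ℂ → ℂ` with values in the open unit disk that fixes the origin and is
holomorphic in the disk. -/
structure IsCenteredDiskMap (f : ℂ → ℂ) : Prop where
  measurable : Measurable f
  differentiableOn : DifferentiableOn ℂ f (ball 0 1)
  norm_lt_one : ∀ z, ‖f z‖ < 1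
  map_zero : f 0 = 0

/-- The identity behind the invariance of the disk under the Möbius maps u ↦ (u - b)/(1 - b̄u). -/
theorem sq_norm_one_sub_conj_mul (u b : ℂ) :
    ‖1 - starRingEnd ℂ b * u‖ ^ 2 - ‖u - b‖ ^ 2 = (1 - ‖u‖ ^ 2) * (1 - ‖b‖ ^ 2) := by
  simp only [Complex.sq_norm, Complex.normSq_apply, Complex.sub_re, Complex.sub_im, Complex.mul_re,
    Complex.mul_im, Complex.one_re, Complex.one_im, Complex.conj_re, Complex.conj_im]
  ring

theorem one_sub_conj_mul_ne_zero {u b : ℂ} (hu : ‖u‖ < 1) (hb : ‖b‖ < 1) :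
    1 - starRingEnd ℂ b * u ≠ 0 := by
  intro h
  have h1 : starRingEnd ℂ b * u = 1 := (sub_eq_zero.1 h).symm
  have h2 : ‖b‖ * ‖u‖ = 1 := by rw [← Complex.norm_conj b, ← norm_mul, h1, norm_one]
  nlinarith [norm_nonneg u, norm_nonneg b]

theorem norm_div_one_sub_conj_mul_lt_one {u b : ℂ} (hu : ‖u‖ < 1) (hb : ‖b‖ < 1) :
    ‖(u - b) / (1 - starRingEnd ℂ b * u)‖ < 1 := by
  have h0 := norm_pos_iff.2 (one_sub_conj_mul_ne_zero hu hb)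
  rw [norm_div, div_lt_one h0]
  refine lt_of_pow_lt_pow_left₀ 2 h0.le ?_
  have h1 := sq_norm_one_sub_conj_mul u b
  have h2 : 0 < (1 - ‖u‖ ^ 2) * (1 - ‖b‖ ^ 2) := by
    apply mul_pos <;> nlinarith [norm_nonneg u, norm_nonneg b]
  linarith

/-- The infinitesimal form of the **Schwarz–Pick lemma**. -/
theorem norm_deriv_mul_le_of_mapsTo_ball {f : ℂ → ℂ} (hf : DifferentiableOn ℂ f (ball 0 1))
    (hmaps : ∀ z ∈ ball (0 : ℂ) 1, ‖f z‖ < 1) {a : ℂ} (ha : ‖a‖ < 1) :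
    ‖deriv f a‖ * (1 - ‖a‖ ^ 2) ≤ 1 - ‖f a‖ ^ 2 := by
  have hab : a ∈ ball (0 : ℂ) 1 := by simpa using ha
  have hb := hmaps a hab
  set b := f a with hbdef
  -- φ moves 0 to a and ψ moves f(a) to 0, with derivatives 1 - |a|² and 1/(1 - |f(a)|²) there. The
  -- claim is then Schwarz's bound at 0 for ψ ∘ f ∘ φ.
  set φ : ℂ → ℂ := fun w => (w - -a) / (1 - starRingEnd ℂ (-a) * w) with hφ
  set ψ : ℂ → ℂ := fun u => (u - b) / (1 - starRingEnd ℂ b * u) with hψ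
  have hna : ‖-a‖ < 1 := by simpa using ha
  have hdiff : ∀ {c w : ℂ}, ‖c‖ < 1 → ‖w‖ < 1 →
      HasDerivAt (fun u => (u - c) / (1 - starRingEnd ℂ c * u))
        ((1 * (1 - starRingEnd ℂ c * w) - (w - c) * (-(starRingEnd ℂ c * 1))) /
          (1 - starRingEnd ℂ c * w) ^ 2) w := fun {c w} hc hw =>
    ((hasDerivAt_id w).sub_const c).div (((hasDerivAt_id w).const_mul _).const_sub 1)
      (one_sub_conj_mul_ne_zero hw hc)
  have hφmaps : ∀ w, ‖w‖ < 1 → ‖φ w‖ < 1 := fun w hw => norm_div_one_sub_conj_mul_lt_one hw hna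
  have hφ0 : φ 0 = a := by simp [hφ]
  have hfd : ∀ w, ‖w‖ < 1 → DifferentiableAt ℂ f w := fun w hw =>
    hf.differentiableAt (isOpen_ball.mem_nhds (by simpa using hw))
  have hg : DifferentiableOn ℂ (ψ ∘ f ∘ φ) (ball 0 1) := by
    intro w hw
    rw [mem_ball_zero_iff] at hw
    have h1 := (hdiff hna hw).differentiableAt
    have h2 := hfd (φ w) (hφmaps w hw)
    have h3 := (hdiff hb (hmaps (φ w) (by simpa using hφmaps w hw))).differentiableAt
    exact (h3.comp w (h2.comp w h1)).differentiableWithinAt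
  have hg0 : (ψ ∘ f ∘ φ) 0 = 0 := by simp [hφ0, hψ, ← hbdef]
  have hgmaps : MapsTo (ψ ∘ f ∘ φ) (ball 0 1) (closedBall ((ψ ∘ f ∘ φ) 0) 1) := by
    intro w hw
    rw [mem_ball_zero_iff] at hw
    rw [hg0, mem_closedBall_zero_iff]
    exact (norm_div_one_sub_conj_mul_lt_one (hmaps (φ w) (by simpa using hφmaps w hw)) hb).le
  have hle := Complex.norm_deriv_le_one_of_mapsTo_ball hg hgmaps one_pos
  have e1 : HasDerivAt φ (1 - ‖a‖ ^ 2 : ℝ) 0 := by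
    refine (hdiff hna (w := 0) (by simp)).congr_deriv ?_
    simp only [map_neg, mul_zero, sub_zero, one_pow, div_one, mul_one, zero_sub, neg_neg]
    rw [Complex.mul_conj, Complex.normSq_eq_norm_sq]
    push_cast; ring
  have hbpos : 0 < 1 - ‖b‖ ^ 2 := by nlinarith [norm_nonneg b]
  have e3 : HasDerivAt ψ ((1 - ‖b‖ ^ 2 : ℝ) : ℂ)⁻¹ b := by
    refine (hdiff hb hb).congr_deriv ?_
    have : starRingEnd ℂ b * b = (‖b‖ ^ 2 : ℝ) := by
      rw [mul_comm, Complex.mul_conj, Complex.normSq_eq_norm_sq]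
    rw [this, sub_self, zero_mul, sub_zero, one_mul, ← Complex.ofReal_one, ← Complex.ofReal_sub]
    have h0 : ((1 - ‖b‖ ^ 2 : ℝ) : ℂ) ≠ 0 := by exact_mod_cast hbpos.ne'
    field_simp
  have e2 : HasDerivAt f (deriv f a) (φ 0) := by rw [hφ0]; exact (hfd a ha).hasDerivAt
  have e3' : HasDerivAt ψ ((1 - ‖b‖ ^ 2 : ℝ) : ℂ)⁻¹ ((f ∘ φ) 0) := by
    rw [Function.comp_apply, hφ0]; exact e3
  rw [(e3'.comp 0 (e2.comp 0 e1)).deriv, norm_mul, norm_mul, norm_inv, Complex.norm_real,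
    Complex.norm_real, Real.norm_of_nonneg hbpos.le,
    Real.norm_of_nonneg (by nlinarith [norm_nonneg a]), inv_mul_le_iff₀ hbpos] at hle
  simpa using hle

namespace IsCenteredDiskMap

variable {f : ℂ → ℂ}

theorem norm_le_norm (hf : IsCenteredDiskMap f) (z : ℂ) : ‖f z‖ ≤ ‖z‖ := by
  by_cases hz : ‖z‖ < 1
  · exact Complex.norm_le_norm_of_mapsTo_ball hf.differentiableOn
      (fun w _ => by simpa using (hf.norm_lt_one w).le) hf.map_zero hz
  · exact (hf.norm_lt_one z).le.trans (not_lt.1 hz)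

theorem schwarzPick (hf : IsCenteredDiskMap f) {z : ℂ} (hz : ‖z‖ < 1) :
    ‖deriv f z‖ * (1 - ‖z‖ ^ 2) ≤ 1 - ‖f z‖ ^ 2 :=
  norm_deriv_mul_le_of_mapsTo_ball hf.differentiableOn (fun w _ => hf.norm_lt_one w) hz

theorem one_sub_sq_pos (hf : IsCenteredDiskMap f) (z : ℂ) : 0 < 1 - ‖f z‖ ^ 2 := by
  nlinarith [norm_nonneg (f z), hf.norm_lt_one z]

/-- The **Littlewood–Paley identity** for the potential `log (1 / (1 - |f|²))` of the pull-back of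
the hyperbolic metric. -/
theorem littlewoodPaley_log (hf : IsCenteredDiskMap f) {R : ℝ} (hR : 0 < R) (hR1 : R < 1) :
    4 * ∫⁻ z in ball 0 1, greenWeight R z *
        (‖deriv f z‖ₑ ^ 2 * ENNReal.ofReal (1 / (1 - ‖f z‖ ^ 2) ^ 2)) =
      circleLIntegral (fun z => ENNReal.ofReal (-Real.log (1 - ‖f z‖ ^ 2))) R := by
  have hpt : ∀ z ∈ ball (0 : ℂ) 1, greenWeight R z *
      (‖deriv f z‖ₑ ^ 2 * ENNReal.ofReal (1 / (1 - ‖f z‖ ^ 2) ^ 2)) =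
      ∑' k : ℕ, ENNReal.ofReal (1 / (k + 1)) *
        (greenWeight R z * ‖deriv (fun w => f w ^ (k + 1)) z‖ₑ ^ 2) := by
    intro z hz
    have hd := (hf.differentiableOn.differentiableAt (isOpen_ball.mem_nhds hz)).hasDerivAt
    -- Expand 1/(1-x)² = Σ (k+1)x^k at x = |f|². Then (k+1)|f|^{2k}|f'|² = |(f^{k+1})'|²/(k+1), so
    -- the Littlewood–Paley identity applies to each power of f.
    have hs := hasSum_choose_mul_geometric_of_norm_lt_one 1 (r := ‖f z‖ ^ 2)
      (by rw [norm_pow, norm_norm]; nlinarith [norm_nonneg (f z), hf.norm_lt_one z])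
    rw [← hs.tsum_eq, ENNReal.ofReal_tsum_of_nonneg (fun n => by positivity) hs.summable,
      ← ENNReal.tsum_mul_left, ← ENNReal.tsum_mul_left]
    refine tsum_congr fun k => ?_
    rw [(hd.fun_pow (k + 1)).deriv, mul_left_comm (ENNReal.ofReal _)]
    congr 1
    rw [← ofReal_norm, ← ofReal_norm, ← ENNReal.ofReal_pow (norm_nonneg _),
      ← ENNReal.ofReal_pow (norm_nonneg _), ← ENNReal.ofReal_mul (by positivity),
      ← ENNReal.ofReal_mul (by positivity)]
    congr 1
    have hk : ‖(((k + 1 : ℕ)) : ℂ)‖ = k + 1 := by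
      rw [Complex.norm_natCast]; push_cast; rfl
    rw [norm_mul, norm_mul, norm_pow, hk, Nat.choose_one_right]
    push_cast
    field_simp
    ring
  rw [setLIntegral_congr_fun measurableSet_ball hpt, lintegral_tsum, ← ENNReal.tsum_mul_left]
  · have hk : ∀ k : ℕ, 4 * ∫⁻ z in ball (0 : ℂ) 1, ENNReal.ofReal (1 / (k + 1)) *
        (greenWeight R z * ‖deriv (fun w => f w ^ (k + 1)) z‖ₑ ^ 2) =
        ∫⁻ θ in Ioo (-Real.pi) Real.pi,
          ENNReal.ofReal (1 / (k + 1)) * ‖f (circleMap 0 R θ) ^ (k + 1)‖ₑ ^ 2 := by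
      intro k
      have hm : Measurable fun z => greenWeight R z * ‖deriv (fun w => f w ^ (k + 1)) z‖ₑ ^ 2 :=
        (measurable_greenWeight R).mul ((measurable_deriv _).enorm.pow_const 2)
      rw [lintegral_const_mul _ hm, mul_left_comm,
        littlewoodPaley (hf.differentiableOn.fun_pow (k + 1)) (by simp [hf.map_zero]) hR hR1,
        circleLIntegral, lintegral_const_mul]
      exact ((hf.measurable.comp (continuous_circleMap 0 R).measurable).pow_const _).enorm.pow_const _
    simp_rw [hk]
    rw [← lintegral_tsum, circleLIntegral]
    · refine lintegral_congr fun θ => ?_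
      set w := f (circleMap 0 R θ)
      have hw : ‖w‖ < 1 := hf.norm_lt_one _
      -- The circle integrals resum by Σ x^{k+1}/(k+1) = -log(1-x).
      have hs := Real.hasSum_pow_div_log_of_abs_lt_one (x := ‖w‖ ^ 2)
        (by rw [abs_of_nonneg (by positivity)]; nlinarith [norm_nonneg w])
      rw [← hs.tsum_eq, ENNReal.ofReal_tsum_of_nonneg (fun n => by positivity) hs.summable]
      refine tsum_congr fun k => ?_
      rw [← ofReal_norm, ← ENNReal.ofReal_pow (norm_nonneg _), ← ENNReal.ofReal_mul (by positivity),
        norm_pow]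
      congr 1
      ring
    · intro k
      exact ((((hf.measurable.comp (continuous_circleMap 0 R).measurable).pow_const _).enorm.pow_const
        _).const_mul _).aemeasurable
  · intro k
    exact (((measurable_greenWeight R).mul
        ((measurable_deriv _).enorm.pow_const 2)).const_mul _).aemeasurable

end IsCenteredDiskMap

/-! ### Exhaustion of the disk -/

/-- Radii that increase to `1`. -/
noncomputable def exhaustionRadius (n : ℕ) : ℝ := 1 - 1 / (n + 2)

theorem exhaustionRadius_pos (n : ℕ) : 0 < exhaustionRadius n := by
  have : (0 : ℝ) < n + 2 := by positivity
  rw [exhaustionRadius, sub_pos, div_lt_one this]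
  linarith [(Nat.cast_nonneg n : (0 : ℝ) ≤ n)]

theorem exhaustionRadius_lt_one (n : ℕ) : exhaustionRadius n < 1 := by
  have : (0 : ℝ) < 1 / (n + 2) := by positivity
  rw [exhaustionRadius]
  linarith

theorem exhaustionRadius_monotone : Monotone exhaustionRadius := by
  intro m n h
  unfold exhaustionRadius
  gcongr

theorem tendsto_exhaustionRadius : Tendsto exhaustionRadius atTop (𝓝 1) := by
  have h : Tendsto (fun n : ℕ => (1 : ℝ) / (n + 2)) atTop (𝓝 0) := by
    have := (tendsto_one_div_add_atTop_nhds_zero_nat (𝕜 := ℝ)).comp (tendsto_add_atTop_nat 1)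
    refine this.congr fun n => ?_
    simp only [Function.comp_apply]
    push_cast
    ring
  have h1 := h.const_sub (1 : ℝ)
  rw [sub_zero] at h1
  exact h1

theorem tendsto_exhaustionRadius_nhdsLT : Tendsto exhaustionRadius atTop (𝓝[<] 1) :=
  tendsto_nhdsWithin_iff.2 ⟨tendsto_exhaustionRadius,
    Eventually.of_forall exhaustionRadius_lt_one⟩

theorem tendsto_lintegral_greenWeight_mul {g : ℂ → ENNReal} (hg : Measurable g) :
    Tendsto (fun n => ∫⁻ z in ball 0 1, greenWeight (exhaustionRadius n) z * g z) atTop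
      (𝓝 (∫⁻ z in ball 0 1, greenWeight 1 z * g z)) := by
  refine lintegral_tendsto_of_tendsto_of_monotone
    (fun n => ((measurable_greenWeight _).mul hg).aemeasurable) ?_ ?_
  · refine Eventually.of_forall fun z m n hmn => ?_
    refine mul_le_mul_left ?_ _
    refine ENNReal.ofReal_le_ofReal ?_
    -- At the origin the default values R/0 = 0 and log 0 = 0 make the weight 0 for every R. This is
    -- harmless, as a point is null.
    rcases eq_or_ne z 0 with rfl | hz
    · simp
    · have hz' : 0 < ‖z‖ := norm_pos_iff.2 hz
      have := exhaustionRadius_pos m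
      refine Real.log_le_log (by positivity) ?_
      gcongr
      exact exhaustionRadius_monotone hmn
  · have hae : ∀ᵐ z ∂(volume.restrict (ball (0 : ℂ) 1)), z ≠ 0 :=
      ae_restrict_of_ae (Measure.ae_ne volume 0)
    filter_upwards [hae, ae_restrict_mem measurableSet_ball] with z hz hz1
    have hz' : 0 < ‖z‖ := norm_pos_iff.2 hz
    refine ENNReal.Tendsto.mul_const ?_ (Or.inl ?_)
    · refine (ENNReal.continuous_ofReal.tendsto _).comp ?_
      refine (Real.continuousAt_log (by positivity)).tendsto.comp ?_
      exact tendsto_exhaustionRadius.div_const _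
    · rw [greenWeight, Ne, ENNReal.ofReal_eq_zero, not_le]
      refine Real.log_pos ?_
      rw [one_lt_div hz']
      simpa using hz1

theorem littlewoodPaley_of_tendsto {h : ℂ → ℂ} (hh : DifferentiableOn ℂ h (ball 0 1))
    (h0 : h 0 = 0) {L : ENNReal} (hL : Tendsto (fun n => circleLIntegral (fun z => ‖h z‖ₑ ^ 2)
      (exhaustionRadius n)) atTop (𝓝 L)) :
    4 * ∫⁻ z in ball 0 1, greenWeight 1 z * ‖deriv h z‖ₑ ^ 2 = L := by
  refine tendsto_nhds_unique (ENNReal.Tendsto.const_mul (tendsto_lintegral_greenWeight_mul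
    ((measurable_deriv h).enorm.pow_const 2)) (Or.inr (by simp))) ?_
  refine hL.congr fun n => ?_
  rw [littlewoodPaley hh h0 (exhaustionRadius_pos n) (exhaustionRadius_lt_one n)]

/-! ### Change of variables for inner functions -/

/-- A centered disk map whose radial limits are unimodular almost everywhere. -/
structure IsCenteredInnerMap (f : ℂ → ℂ) : Prop extends IsCenteredDiskMap f where
  ae_tendsto_norm : ∀ᵐ θ : ℝ,
    Tendsto (fun n => ‖f (circleMap 0 (exhaustionRadius n) θ)‖) atTop (𝓝 1)

/-- The measure `log (1 / |z|) |f'(z)|² dx dy` on the unit disk. -/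
noncomputable def greenMeasure (f : ℂ → ℂ) : Measure ℂ :=
  (volume.restrict (ball 0 1)).withDensity fun z => greenWeight 1 z * ‖deriv f z‖ₑ ^ 2

theorem lintegral_greenMeasure (f : ℂ → ℂ) {g : ℂ → ENNReal} (hg : Measurable g) :
    ∫⁻ z, g z ∂greenMeasure f =
      ∫⁻ z in ball 0 1, greenWeight 1 z * (‖deriv f z‖ₑ ^ 2 * g z) := by
  have hm : Measurable fun z => greenWeight 1 z * ‖deriv f z‖ₑ ^ 2 :=
    (measurable_greenWeight 1).mul ((measurable_deriv f).enorm.pow_const 2)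
  rw [greenMeasure, lintegral_withDensity_eq_lintegral_mul _ hm hg]
  simp only [Pi.mul_apply, mul_assoc]

namespace IsCenteredDiskMap

variable {f : ℂ → ℂ}

theorem continuousOn_exhaustion (hf : IsCenteredDiskMap f) (n : ℕ) :
    ContinuousOn f (sphere 0 |exhaustionRadius n|) :=
  continuousOn_sphere_of_differentiableOn hf.differentiableOn (exhaustionRadius_pos n).le
    (exhaustionRadius_lt_one n)

/-- Mean value property: the holomorphic function c·f^j vanishes at the origin. -/
theorem circleAverage_re_mul_pow (hf : IsCenteredDiskMap f) (c : ℂ) {j : ℕ} (hj : j ≠ 0) (n : ℕ) :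
    Real.circleAverage (fun z => (c * f z ^ j).re) 0 (exhaustionRadius n) = 0 := by
  have hcont : ContinuousOn (fun z => c * f z ^ j) (sphere 0 |exhaustionRadius n|) :=
    continuousOn_const.mul ((hf.continuousOn_exhaustion n).pow j)
  have h := Complex.reCLM.circleAverage_comp_comm hcont.circleIntegrable'
  have hd : DiffContOnCl ℂ (fun z => c * f z ^ j) (ball 0 |exhaustionRadius n|) := by
    refine DifferentiableOn.diffContOnCl ?_
    refine ((hf.differentiableOn.fun_pow j).const_mul c).mono ?_
    refine closure_ball_subset_closedBall.trans (closedBall_subset_ball ?_)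
    rw [abs_of_pos (exhaustionRadius_pos n)]
    exact exhaustionRadius_lt_one n
  rw [hd.circleAverage, hf.map_zero, zero_pow hj] at h
  simpa [Function.comp_def] using h

theorem tendsto_circleAverage_comp (hf : IsCenteredDiskMap f) {G : ℂ → ℝ} (hG : Continuous G)
    {L : ℝ} (hL : ∀ᵐ θ : ℝ,
      Tendsto (fun n => G (f (circleMap 0 (exhaustionRadius n) θ))) atTop (𝓝 L)) :
    Tendsto (fun n => Real.circleAverage (fun z => G (f z)) 0 (exhaustionRadius n)) atTop
      (𝓝 L) := by
  obtain ⟨C, hC⟩ := (isCompact_closedBall (0 : ℂ) 1).exists_bound_of_continuousOn hG.continuousOn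
  have key : Tendsto (fun n => ∫ θ in (0 : ℝ)..(2 * Real.pi),
      G (f (circleMap 0 (exhaustionRadius n) θ))) atTop (𝓝 (∫ _ in (0 : ℝ)..(2 * Real.pi), L)) := by
    refine intervalIntegral.tendsto_integral_filter_of_dominated_convergence (fun _ => C) ?_ ?_
      intervalIntegrable_const ?_
    · exact Eventually.of_forall fun n => (hG.measurable.comp (hf.measurable.comp
        (continuous_circleMap 0 _).measurable)).aestronglyMeasurable
    · exact Eventually.of_forall fun n => Eventually.of_forall fun θ _ =>
        hC _ (by simpa using (hf.norm_lt_one _).le)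
    · exact hL.mono fun θ h _ => h
  have h2 := key.const_smul (2 * Real.pi)⁻¹
  have hval : (2 * Real.pi)⁻¹ • ∫ _ in (0 : ℝ)..(2 * Real.pi), L = L := by
    rw [intervalIntegral.integral_const, sub_zero, smul_smul, inv_mul_cancel₀ (by positivity),
      one_smul]
  rw [hval] at h2
  exact h2

end IsCenteredDiskMap

/-- The subtracted cross term is harmonic in z when w = f(z). What remains tends to |a|² + |b|² as
|w| → 1, whatever the argument of w does. -/
theorem sq_norm_mul_pow_add_mul_pow (a b w : ℂ) (n j : ℕ) :
    ‖a * w ^ (n + j) + b * w ^ n‖ ^ 2 - 2 * (starRingEnd ℂ b * a * w ^ j).re =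
      ‖a‖ ^ 2 * ‖w‖ ^ (2 * (n + j)) + ‖b‖ ^ 2 * ‖w‖ ^ (2 * n) +
        2 * (‖w‖ ^ (2 * n) - 1) * (starRingEnd ℂ b * a * w ^ j).re := by
  rw [Complex.sq_norm, Complex.normSq_add, Complex.normSq_eq_norm_sq, Complex.normSq_eq_norm_sq]
  have : a * w ^ (n + j) * starRingEnd ℂ (b * w ^ n) =
      ((‖w‖ ^ (2 * n) : ℝ) : ℂ) * (starRingEnd ℂ b * a * w ^ j) := by
    rw [pow_mul, ← Complex.normSq_eq_norm_sq, Complex.ofReal_pow, Complex.normSq_eq_conj_mul_self,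
      map_mul, map_pow]
    ring
  rw [this, Complex.re_ofReal_mul, norm_mul, norm_mul, norm_pow, norm_pow]
  ring

namespace IsCenteredInnerMap

variable {f g : ℂ → ℂ}

/-- Distinct powers of an inner function are orthonormal in the limit: the cross term averages to
zero on every circle, and dominated convergence handles the rest. -/
theorem tendsto_circleAverage_of_lt (hf : IsCenteredInnerMap f) (a b : ℂ) (n : ℕ) {j : ℕ}
    (hj : j ≠ 0) : Tendsto (fun k => Real.circleAverage
      (fun z => ‖a * f z ^ (n + j) + b * f z ^ n‖ ^ 2) 0 (exhaustionRadius k)) atTop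
      (𝓝 (‖a‖ ^ 2 + ‖b‖ ^ 2)) := by
  set G : ℂ → ℝ := fun w => ‖a * w ^ (n + j) + b * w ^ n‖ ^ 2 -
    2 * (starRingEnd ℂ b * a * w ^ j).re with hG
  have hGc : Continuous G := by rw [hG]; fun_prop
  have h1 := hf.tendsto_circleAverage_comp hGc (L := ‖a‖ ^ 2 + ‖b‖ ^ 2) ?_
  · refine h1.congr fun k => ?_
    have hc := hf.continuousOn_exhaustion k
    have e2 := hf.circleAverage_re_mul_pow (2 * (starRingEnd ℂ b * a)) hj k
    have hi1 : CircleIntegrable (fun z => G (f z)) 0 (exhaustionRadius k) :=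
      (hGc.comp_continuousOn hc).circleIntegrable'
    have hi2 : CircleIntegrable (fun z => (2 * (starRingEnd ℂ b * a) * f z ^ j).re) 0
        (exhaustionRadius k) :=
      (Complex.continuous_re.comp_continuousOn
        (continuousOn_const.mul (hc.pow j))).circleIntegrable'
    rw [← add_zero (Real.circleAverage (fun z => G (f z)) 0 (exhaustionRadius k)), ← e2,
      ← Real.circleAverage_fun_add hi1 hi2]
    congr 1
    funext z
    simp only [hG]
    rw [show 2 * (starRingEnd ℂ b * a) * f z ^ j = ((2 : ℝ) : ℂ) * (starRingEnd ℂ b * a * f z ^ j) by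
      push_cast; ring, Complex.re_ofReal_mul]
    ring
  · filter_upwards [hf.ae_tendsto_norm] with θ hθ
    simp only [hG, sq_norm_mul_pow_add_mul_pow]
    set w : ℕ → ℂ := fun k => f (circleMap 0 (exhaustionRadius k) θ)
    have t1 := ((hθ.pow (2 * (n + j))).const_mul (‖a‖ ^ 2)).add
      ((hθ.pow (2 * n)).const_mul (‖b‖ ^ 2))
    have t2 : Tendsto (fun k => 2 * (‖w k‖ ^ (2 * n) - 1) * (starRingEnd ℂ b * a * w k ^ j).re)
        atTop (𝓝 0) := by
      have t3 : Tendsto (fun k => 2 * (‖w k‖ ^ (2 * n) - 1)) atTop (𝓝 0) := by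
        simpa using ((hθ.pow (2 * n)).sub_const 1).const_mul 2
      refine t3.zero_mul_isBoundedUnder_le ?_
      refine isBoundedUnder_of ⟨‖starRingEnd ℂ b * a‖, fun k => ?_⟩
      refine (Complex.abs_re_le_norm _).trans ?_
      rw [norm_mul, norm_pow]
      exact mul_le_of_le_one_right (norm_nonneg _)
        (pow_le_one₀ (norm_nonneg _) (hf.norm_lt_one _).le)
    simpa using t1.add t2

/-- The order of quantifiers is the point: K serves all inner maps at once. -/
theorem exists_tendsto_circleLIntegral (m n : ℕ) (c : ℂ) : ∃ K : ENNReal, K ≠ ⊤ ∧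
    ∀ f, IsCenteredInnerMap f → Tendsto (fun k => circleLIntegral
      (fun z => ‖f z ^ m + c * f z ^ n‖ₑ ^ 2) (exhaustionRadius k)) atTop (𝓝 K) := by
  suffices h : ∃ K : ℝ, ∀ f, IsCenteredInnerMap f → Tendsto (fun k => Real.circleAverage
      (fun z => ‖f z ^ m + c * f z ^ n‖ ^ 2) 0 (exhaustionRadius k)) atTop (𝓝 K) by
    obtain ⟨K, hK⟩ := h
    refine ⟨ENNReal.ofReal (2 * Real.pi * K), ENNReal.ofReal_ne_top, fun f hf => ?_⟩
    refine (ENNReal.tendsto_ofReal ((hK f hf).const_mul (2 * Real.pi))).congr fun k => ?_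
    have hc := hf.continuousOn_exhaustion k
    have hc' : ContinuousOn (fun z => f z ^ m + c * f z ^ n) (sphere 0 |exhaustionRadius k|) :=
      (hc.pow m).add (continuousOn_const.mul (hc.pow n))
    rw [circleLIntegral_enorm_sq hc']
  rcases lt_trichotomy m n with h | rfl | h
  · obtain ⟨j, rfl⟩ := Nat.exists_eq_add_of_lt h
    refine ⟨‖c‖ ^ 2 + ‖(1 : ℂ)‖ ^ 2, fun f hf => ?_⟩
    refine (hf.tendsto_circleAverage_of_lt c 1 m (j := j + 1) (by simp)).congr fun k => ?_
    simp only [one_mul, add_comm, add_assoc]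
  · refine ⟨‖1 + c‖ ^ 2, fun f hf => ?_⟩
    refine hf.tendsto_circleAverage_comp (G := fun w => ‖w ^ m + c * w ^ m‖ ^ 2) (by fun_prop) ?_
    filter_upwards [hf.ae_tendsto_norm] with θ hθ
    have h : ∀ w : ℂ, ‖w ^ m + c * w ^ m‖ ^ 2 = ‖w‖ ^ (2 * m) * ‖1 + c‖ ^ 2 := fun w => by
      rw [← one_add_mul, norm_mul, norm_pow]
      ring
    simp only [h]
    simpa using (hθ.pow (2 * m)).mul_const (‖1 + c‖ ^ 2)
  · obtain ⟨j, rfl⟩ := Nat.exists_eq_add_of_lt h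
    refine ⟨‖(1 : ℂ)‖ ^ 2 + ‖c‖ ^ 2, fun f hf => ?_⟩
    refine (hf.tendsto_circleAverage_of_lt 1 c n (j := j + 1) (by simp)).congr fun k => ?_
    simp only [one_mul, add_assoc]

/-- Littlewood–Paley for h = f^{a+1} + c f^{b+1}, whose derivative is f' times the integrand here.
-/
theorem exists_lintegral_greenMeasure (a b : ℕ) (c : ℂ) : ∃ K : ENNReal, K ≠ ⊤ ∧
    ∀ f, IsCenteredInnerMap f →
      ∫⁻ z, ‖(a + 1) * f z ^ a + c * ((b + 1) * f z ^ b)‖ₑ ^ 2 ∂greenMeasure f = K := by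
  obtain ⟨K, hKtop, hK⟩ := exists_tendsto_circleLIntegral (a + 1) (b + 1) c
  refine ⟨K / 4, ENNReal.div_ne_top hKtop (by simp), fun f hf => ?_⟩
  have h := littlewoodPaley_of_tendsto (h := fun z => f z ^ (a + 1) + c * f z ^ (b + 1))
    ((hf.differentiableOn.fun_pow _).fun_add ((hf.differentiableOn.fun_pow _).const_mul c))
    (by simp [hf.map_zero]) (hK f hf)
  rw [lintegral_greenMeasure]
  · rw [ENNReal.eq_div_iff (by simp) (by simp), ← h]
    congr 1
    refine setLIntegral_congr_fun measurableSet_ball fun z hz => ?_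
    have hd := (hf.differentiableOn.differentiableAt (isOpen_ball.mem_nhds hz)).hasDerivAt
    rw [((hd.fun_pow (a + 1)).fun_add ((hd.fun_pow (b + 1)).const_mul c)).deriv]
    rw [← mul_pow, ← enorm_mul]
    congr 3
    push_cast [Nat.add_sub_cancel]
    ring
  · have := hf.measurable
    fun_prop

theorem greenMeasure_univ_ne_top (hf : IsCenteredInnerMap f) : greenMeasure f univ ≠ ⊤ := by
  obtain ⟨K, hK, h⟩ := exists_lintegral_greenMeasure 0 0 0
  have := h f hf
  simp at this
  rwa [this]

theorem isFiniteMeasure_greenMeasure (hf : IsCenteredInnerMap f) :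
    IsFiniteMeasure (greenMeasure f) :=
  ⟨hf.greenMeasure_univ_ne_top.lt_top⟩

/-- Polarization of the preceding quadratic integrals over c = ±1, ±i. -/
theorem integral_pow_mul_conj_pow (hf : IsCenteredInnerMap f) (hg : IsCenteredInnerMap g)
    (a b : ℕ) : ∫ z, f z ^ a * starRingEnd ℂ (f z) ^ b ∂greenMeasure f =
      ∫ z, g z ^ a * starRingEnd ℂ (g z) ^ b ∂greenMeasure g := by
  set q : ℂ → ℂ → ℝ := fun c w => ‖((a : ℂ) + 1) * w ^ a + c * ((b + 1) * w ^ b)‖ ^ 2 with hq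
  have hqc : ∀ c, Continuous (q c) := fun c => by rw [hq]; fun_prop
  have hint : ∀ {f}, IsCenteredInnerMap f → ∀ c, Integrable (fun z => q c (f z)) (greenMeasure f) := by
    intro f hf c
    have := hf.isFiniteMeasure_greenMeasure
    obtain ⟨C, hC⟩ :=
      (isCompact_closedBall (0 : ℂ) 1).exists_bound_of_continuousOn (hqc c).continuousOn
    refine Integrable.of_bound ((hqc c).measurable.comp hf.measurable).aestronglyMeasurable C ?_
    exact Eventually.of_forall fun z => hC _ (by simpa using (hf.norm_lt_one z).le)
  have heq : ∀ c, ∫ z, q c (f z) ∂greenMeasure f = ∫ z, q c (g z) ∂greenMeasure g := by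
    intro c
    obtain ⟨K, -, hK⟩ := exists_lintegral_greenMeasure a b c
    have h : ∀ {f}, IsCenteredInnerMap f → ∫ z, q c (f z) ∂greenMeasure f = K.toReal := by
      intro f hf
      rw [integral_eq_lintegral_of_nonneg_ae (Eventually.of_forall fun z => by positivity)
        (hint hf c).aestronglyMeasurable, ← hK f hf]
      congr 1
      refine lintegral_congr fun z => ?_
      rw [hq, ENNReal.ofReal_pow (norm_nonneg _), ofReal_norm]
    rw [h hf, h hg]
  have hpol : ∀ w : ℂ, w ^ a * starRingEnd ℂ w ^ b = (4 * ((a + 1) * (b + 1)) : ℂ)⁻¹ *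
      (((q 1 w : ℝ) : ℂ) - ((q (-1) w : ℝ) : ℂ) + Complex.I * ((q Complex.I w : ℝ) : ℂ) -
        Complex.I * ((q (-Complex.I) w : ℝ) : ℂ)) := by
    intro w
    have ha : (a : ℂ) + 1 ≠ 0 := by exact_mod_cast a.succ_ne_zero
    have hb : (b : ℂ) + 1 ≠ 0 := by exact_mod_cast b.succ_ne_zero
    rw [eq_inv_mul_iff_mul_eq₀ (by simp [ha, hb])]
    simp only [hq, ← Complex.normSq_eq_norm_sq, Complex.normSq_eq_conj_mul_self, map_add, map_mul,
      map_pow, map_natCast, map_one, map_neg, Complex.conj_I]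
    ring_nf
    rw [Complex.I_sq]
    ring
  have hfinal : ∀ {f}, IsCenteredInnerMap f →
      ∫ z, f z ^ a * starRingEnd ℂ (f z) ^ b ∂greenMeasure f = (4 * ((a + 1) * (b + 1)) : ℂ)⁻¹ *
      (((∫ z, q 1 (f z) ∂greenMeasure f : ℝ) : ℂ) - ((∫ z, q (-1) (f z) ∂greenMeasure f : ℝ) : ℂ) +
        Complex.I * ((∫ z, q Complex.I (f z) ∂greenMeasure f : ℝ) : ℂ) -
        Complex.I * ((∫ z, q (-Complex.I) (f z) ∂greenMeasure f : ℝ) : ℂ)) := by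
    intro f hf
    have i := fun c => (hint hf c).ofReal (𝕜 := ℂ)
    simp_rw [hpol]
    rw [integral_const_mul, integral_sub, integral_add, integral_sub, integral_const_mul,
      integral_const_mul]
    · simp only [← integral_complex_ofReal]
    · exact i 1
    · exact i (-1)
    · exact (i 1).sub (i (-1))
    · exact (i _).const_mul _
    · exact ((i 1).sub (i (-1))).add ((i _).const_mul _)
    · exact (i _).const_mul _
  rw [hfinal hf, hfinal hg, heq, heq, heq, heq]

end IsCenteredInnerMap

/-- Finite measures on the closed unit disk are determined by their moments. -/
theorem ext_of_integral_pow_mul_conj_pow {P Q : Measure (closedBall (0 : ℂ) 1)} [IsFiniteMeasure P]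
    [IsFiniteMeasure Q]
    (h : ∀ a b : ℕ, ∫ w, (w : ℂ) ^ a * starRingEnd ℂ (w : ℂ) ^ b ∂P =
      ∫ w, (w : ℂ) ^ a * starRingEnd ℂ (w : ℂ) ^ b ∂Q) : P = Q := by
  -- The coordinate function generates a point-separating star subalgebra, and this algebra is
  -- spanned by the monomials X^a X̄^b.
  set X : BoundedContinuousFunction (closedBall (0 : ℂ) 1) ℂ :=
    BoundedContinuousFunction.mkOfCompact ⟨Subtype.val, continuous_subtype_val⟩ with hX
  refine ext_of_forall_mem_subalgebra_integral_eq_of_polish (𝕜 := ℂ)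
    (A := StarAlgebra.adjoin ℂ {X}) ?_ ?_
  · intro x y hxy
    refine ⟨fun w => (w : ℂ), ?_, fun hval => hxy (Subtype.ext hval)⟩
    exact ⟨_, ⟨X, StarAlgebra.subset_adjoin ℂ _ rfl, rfl⟩, rfl⟩
  · intro p hp
    rw [← StarSubalgebra.mem_toSubalgebra, StarAlgebra.adjoin_toSubalgebra,
      ← Subalgebra.mem_toSubmodule, Algebra.adjoin_eq_span] at hp
    have hmon : ∀ p ∈ Submonoid.closure ({X} ∪ star {X}), ∃ a b : ℕ, p = X ^ a * star X ^ b := by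
      intro p hp
      induction hp using Submonoid.closure_induction with
      | mem p hx =>
        rcases hx with hx | hx
        · exact ⟨1, 0, by simpa using hx⟩
        · exact ⟨0, 1, by
            rw [pow_zero, one_mul, pow_one, ← star_star p]
            exact congrArg star hx⟩
      | one => exact ⟨0, 0, by simp⟩
      | mul x y _ _ hx hy =>
        obtain ⟨a, b, rfl⟩ := hx
        obtain ⟨a', b', rfl⟩ := hy
        exact ⟨a + a', b + b', by ring⟩
    induction hp using Submodule.span_induction with
    | mem x hx =>
      obtain ⟨a, b, rfl⟩ := hmon x hx
      exact h a b
    | zero => simp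
    | add x y _ _ hx hy =>
      simp only [BoundedContinuousFunction.coe_add, Pi.add_apply]
      rw [integral_add (x.integrable _) (y.integrable _), integral_add (x.integrable _) (y.integrable _),
        hx, hy]
    | smul c x _ hx =>
      simp only [BoundedContinuousFunction.coe_smul]
      rw [integral_smul, integral_smul, hx]

/-- The change of variables formula for inner functions: the image of `log (1 / |z|) |f'|² dx dy`
under `f` does not depend on `f`. -/
theorem IsCenteredInnerMap.map_greenMeasure_eq {f g : ℂ → ℂ} (hf : IsCenteredInnerMap f)
    (hg : IsCenteredInnerMap g) : (greenMeasure f).map f = (greenMeasure g).map g := by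
  have mem : ∀ {f}, IsCenteredInnerMap f → ∀ z, f z ∈ closedBall (0 : ℂ) 1 := fun hf z => by
    simpa using (hf.norm_lt_one z).le
  have meas : ∀ {f} (hf : IsCenteredInnerMap f),
      Measurable fun z => (⟨f z, mem hf z⟩ : closedBall (0 : ℂ) 1) := fun hf =>
    hf.measurable.subtype_mk
  have hmap : ∀ {f} (hf : IsCenteredInnerMap f), (greenMeasure f).map f =
      ((greenMeasure f).map fun z => (⟨f z, mem hf z⟩ : closedBall (0 : ℂ) 1)).map Subtype.val := by
    intro f hf
    rw [Measure.map_map measurable_subtype_coe (meas hf)]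
    rfl
  have := hf.isFiniteMeasure_greenMeasure
  have := hg.isFiniteMeasure_greenMeasure
  rw [hmap hf, hmap hg]
  congr 1
  refine ext_of_integral_pow_mul_conj_pow fun a b => ?_
  have hc : Continuous fun w : closedBall (0 : ℂ) 1 => (w : ℂ) ^ a * starRingEnd ℂ (w : ℂ) ^ b := by
    have := Complex.continuous_conj
    fun_prop
  rw [integral_map (meas hf).aemeasurable hc.aestronglyMeasurable,
    integral_map (meas hg).aemeasurable hc.aestronglyMeasurable]
  exact hf.integral_pow_mul_conj_pow hg a b

/-! ### The height measure and its defect -/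

/-- The identity of the unit disk, extended by zero. -/
noncomputable def diskId : ℂ → ℂ := (ball (0 : ℂ) 1).indicator id

theorem diskId_apply {z : ℂ} (hz : ‖z‖ < 1) : diskId z = z :=
  indicator_of_mem (by simpa using hz) id

/-- Extension by zero gives a measurable self-map of the whole plane, so that it can be iterated and
measures can be pushed forward. -/
theorem isCenteredDiskMap_indicator {f : ℂ → ℂ} (hd : DifferentiableOn ℂ f (ball 0 1))
    (hmaps : MapsTo f (ball 0 1) (ball 0 1)) (h0 : f 0 = 0) :
    IsCenteredDiskMap ((ball (0 : ℂ) 1).indicator f) where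
  measurable := by
    classical
    have h := ContinuousOn.measurable_piecewise (g := fun _ : ℂ => (0 : ℂ)) hd.continuousOn
      continuousOn_const measurableSet_ball
    exact (piecewise_eq_indicator (s := ball (0 : ℂ) 1) (f := f)) ▸ h
  differentiableOn := hd.congr fun z hz => indicator_of_mem hz f
  norm_lt_one z := by
    by_cases hz : z ∈ ball (0 : ℂ) 1
    · rw [indicator_of_mem hz]
      simpa using hmaps hz
    · simp [indicator_of_notMem hz]
  map_zero := by rw [indicator_of_mem (mem_ball_self one_pos), h0]

theorem isCenteredInnerMap_diskId : IsCenteredInnerMap diskId where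
  toIsCenteredDiskMap :=
    isCenteredDiskMap_indicator differentiableOn_id (mapsTo_id _) rfl
  ae_tendsto_norm := Eventually.of_forall fun θ => by
    have h : ∀ n, ‖diskId (circleMap 0 (exhaustionRadius n) θ)‖ = exhaustionRadius n := fun n => by
      have : ‖circleMap 0 (exhaustionRadius n) θ‖ = exhaustionRadius n := by
        simp [abs_of_pos (exhaustionRadius_pos n)]
      rw [diskId_apply (by rw [this]; exact exhaustionRadius_lt_one n), this]
    simp only [h]
    exact tendsto_exhaustionRadius

theorem deriv_diskId {z : ℂ} (hz : ‖z‖ < 1) : deriv diskId z = 1 := by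
  have h : diskId =ᶠ[𝓝 z] id := by
    filter_upwards [isOpen_ball.mem_nhds (show z ∈ ball (0 : ℂ) 1 by simpa using hz)] with w hw
    exact diskId_apply (by simpa using hw)
  rw [h.deriv_eq, deriv_id]

/-- The density, up to a factor `4`, of the area of the pull-back of the hyperbolic metric by `f`. -/
noncomputable def pullbackDensity (f : ℂ → ℂ) (z : ℂ) : ENNReal :=
  ‖deriv f z‖ₑ ^ 2 * ENNReal.ofReal (1 / (1 - ‖f z‖ ^ 2) ^ 2)

/-- The difference between the density of the hyperbolic area and that of its pull-back by `f`, up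
to a factor `4`. -/
noncomputable def defectDensity (f : ℂ → ℂ) (z : ℂ) : ENNReal :=
  ENNReal.ofReal (1 / (1 - ‖z‖ ^ 2) ^ 2 - ‖deriv f z‖ ^ 2 / (1 - ‖f z‖ ^ 2) ^ 2)

/-- The measure on the unit disk with density `(1 / 2π) log (1 / |z|) 4 ρ(z)`. -/
noncomputable def potentialMeasure (ρ : ℂ → ENNReal) : Measure ℂ :=
  (volume.restrict (ball 0 1)).withDensity fun z =>
    ENNReal.ofReal (2 / Real.pi) * (greenWeight 1 z * ρ z)

/-- The measure `(1 / 2π) log (1 / |z|) dA_hyp`. -/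
noncomputable def heightMeasure : Measure ℂ := potentialMeasure (pullbackDensity diskId)

/-- The loss of mass of `heightMeasure` under the contraction of the hyperbolic metric by `f`. -/
noncomputable def defectMeasure (f : ℂ → ℂ) : Measure ℂ := potentialMeasure (defectDensity f)

theorem measurable_pullbackDensity {f : ℂ → ℂ} (hf : Measurable f) :
    Measurable (pullbackDensity f) := by
  have := measurable_deriv f
  unfold pullbackDensity
  fun_prop

theorem measurable_defectDensity {f : ℂ → ℂ} (hf : Measurable f) :
    Measurable (defectDensity f) := by
  have := measurable_deriv f
  unfold defectDensity
  fun_prop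

theorem pullbackDensity_diskId {z : ℂ} (hz : ‖z‖ < 1) :
    pullbackDensity diskId z = ENNReal.ofReal (1 / (1 - ‖z‖ ^ 2) ^ 2) := by
  rw [pullbackDensity, deriv_diskId hz, diskId_apply hz]
  simp

theorem potentialMeasure_apply {ρ : ℂ → ENNReal} (s : Set ℂ) :
    potentialMeasure ρ s =
      ∫⁻ z in s, ENNReal.ofReal (2 / Real.pi) * (greenWeight 1 z * ρ z) ∂volume.restrict (ball 0 1) :=
  withDensity_apply' _ s

theorem heightArea_eq {E : Set ℂ} (hE : MeasurableSet E) : heightArea E = heightMeasure E := by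
  have hm : Measurable fun z : ℂ => ENNReal.ofReal (4 / (1 - ‖z‖ ^ 2) ^ 2) := by fun_prop
  have hg : Measurable fun z : ℂ => ENNReal.ofReal (Real.log (1 / ‖z‖)) := by fun_prop
  rw [heightArea, hyperbolicArea, restrict_withDensity hE,
    lintegral_withDensity_eq_lintegral_mul _ hm hg, heightMeasure, potentialMeasure_apply,
    ← lintegral_const_mul _ (hm.mul hg), Measure.restrict_restrict hE]
  refine setLIntegral_congr_fun (hE.inter measurableSet_ball) fun z hz => ?_
  have hz1 : ‖z‖ < 1 := by simpa using hz.2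
  simp only [Pi.mul_apply, greenWeight]
  rw [pullbackDensity_diskId hz1, mul_comm (ENNReal.ofReal (Real.log _)), ← mul_assoc, ← mul_assoc]
  congr 1
  rw [← ENNReal.ofReal_mul (by positivity), ← ENNReal.ofReal_mul (by positivity)]
  congr 1
  field_simp
  norm_num

namespace IsCenteredDiskMap

variable {f : ℂ → ℂ}

/-- Schwarz–Pick squared. It ensures that `ENNReal.ofReal` truncates nothing in `defectDensity`. -/
theorem defect_nonneg (hf : IsCenteredDiskMap f) {z : ℂ} (hz : ‖z‖ < 1) :
    0 ≤ 1 / (1 - ‖z‖ ^ 2) ^ 2 - ‖deriv f z‖ ^ 2 / (1 - ‖f z‖ ^ 2) ^ 2 := by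
  have h1 : 0 < 1 - ‖z‖ ^ 2 := by nlinarith [norm_nonneg z]
  have h2 := hf.one_sub_sq_pos z
  rw [sub_nonneg, div_le_div_iff₀ (by positivity) (by positivity), one_mul, ← mul_pow]
  exact pow_le_pow_left₀ (by positivity) (hf.schwarzPick hz) 2

theorem pullbackDensity_add_defectDensity (hf : IsCenteredDiskMap f) {z : ℂ} (hz : ‖z‖ < 1) :
    pullbackDensity f z + defectDensity f z = pullbackDensity diskId z := by
  rw [pullbackDensity_diskId hz, pullbackDensity, defectDensity, ← ofReal_norm,
    ← ENNReal.ofReal_pow (norm_nonneg _), ← ENNReal.ofReal_mul (by positivity),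
    ← ENNReal.ofReal_add (by positivity) (hf.defect_nonneg hz)]
  congr 1
  ring

theorem heightMeasure_eq_add (hf : IsCenteredDiskMap f) :
    heightMeasure = potentialMeasure (pullbackDensity f) + defectMeasure f := by
  rw [heightMeasure, defectMeasure, potentialMeasure, potentialMeasure, potentialMeasure,
    ← withDensity_add_left]
  · refine withDensity_congr_ae ?_
    filter_upwards [ae_restrict_mem measurableSet_ball] with z hz
    simp only [Pi.add_apply]
    rw [← hf.pullbackDensity_add_defectDensity (by simpa using hz), mul_add, mul_add]
  · exact ((measurable_greenWeight 1).mul (measurable_pullbackDensity hf.measurable)).const_mul _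

/-- The Green potential of the defect is the circle average of `log ((1 - |f|²) / (1 - |z|²))`. -/
theorem four_mul_lintegral_defectDensity (hf : IsCenteredDiskMap f) {R : ℝ} (hR : 0 < R)
    (hR1 : R < 1) :
    4 * ∫⁻ z in ball 0 1, greenWeight R z * defectDensity f z = circleLIntegral
      (fun z => ENNReal.ofReal (Real.log ((1 - ‖f z‖ ^ 2) / (1 - ‖z‖ ^ 2)))) R := by
  have hgw := measurable_greenWeight R
  have h1 := hf.littlewoodPaley_log hR hR1
  have h2 := isCenteredInnerMap_diskId.littlewoodPaley_log hR hR1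
  have hsum : ∫⁻ z in ball 0 1, greenWeight R z * pullbackDensity diskId z =
      (∫⁻ z in ball 0 1, greenWeight R z * pullbackDensity f z) +
        ∫⁻ z in ball 0 1, greenWeight R z * defectDensity f z := by
    have hm : Measurable fun z => greenWeight R z * pullbackDensity f z :=
      hgw.mul (measurable_pullbackDensity hf.measurable)
    rw [← lintegral_add_left hm]
    refine setLIntegral_congr_fun measurableSet_ball fun z hz => ?_
    rw [← mul_add, hf.pullbackDensity_add_defectDensity (by simpa using hz)]
  have hnorm : ∀ θ, ‖circleMap 0 R θ‖ = R := fun θ => by simp [abs_of_pos hR]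
  have hR2 : 0 < 1 - R ^ 2 := by nlinarith
  have hcm : Measurable fun θ => f (circleMap 0 R θ) :=
    hf.measurable.comp (continuous_circleMap 0 R).measurable
  have hle : ∀ θ, 1 - R ^ 2 ≤ 1 - ‖f (circleMap 0 R θ)‖ ^ 2 := fun θ => by
    have h := hf.norm_le_norm (circleMap 0 R θ)
    rw [hnorm] at h
    have := pow_le_pow_left₀ (norm_nonneg _) h 2
    linarith
  have hcirc : circleLIntegral (fun z => ENNReal.ofReal (-Real.log (1 - ‖diskId z‖ ^ 2))) R =
      circleLIntegral (fun z => ENNReal.ofReal (-Real.log (1 - ‖f z‖ ^ 2))) R + circleLIntegral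
      (fun z => ENNReal.ofReal (Real.log ((1 - ‖f z‖ ^ 2) / (1 - ‖z‖ ^ 2)))) R := by
    rw [circleLIntegral, circleLIntegral, circleLIntegral, ← lintegral_add_left]
    · refine lintegral_congr fun θ => ?_
      have hθ := hle θ
      rw [diskId_apply (by rw [hnorm]; exact hR1), hnorm, ← ENNReal.ofReal_add]
      · congr 1
        rw [Real.log_div (by linarith) hR2.ne']
        ring
      · rw [Left.nonneg_neg_iff]
        refine Real.log_nonpos (by linarith) ?_
        linarith [sq_nonneg ‖f (circleMap 0 R θ)‖]
      · exact Real.log_nonneg ((one_le_div hR2).2 hθ)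
    · exact (Real.measurable_log.comp ((hcm.norm.pow_const 2).const_sub 1)).neg.ennreal_ofReal
  -- Finiteness permits cancelling the term of f in [0, ∞]; this is why the identity is proved for R
  -- < 1 first.
  have hfin : circleLIntegral (fun z => ENNReal.ofReal (-Real.log (1 - ‖f z‖ ^ 2))) R ≠ ⊤ := by
    refine ne_top_of_le_ne_top (b := ∫⁻ θ in Ioo (-Real.pi) Real.pi,
      ENNReal.ofReal (-Real.log (1 - R ^ 2))) ?_ (lintegral_mono fun θ => ?_)
    · rw [setLIntegral_const]
      exact ENNReal.mul_ne_top ENNReal.ofReal_ne_top (by simp)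
    · exact ENNReal.ofReal_le_ofReal (neg_le_neg (Real.log_le_log hR2 (hle θ)))
  rw [hcirc, ← h1] at h2
  change 4 * ∫⁻ z in ball 0 1, greenWeight R z * pullbackDensity diskId z = _ at h2
  rw [hsum, mul_add] at h2
  refine (ENNReal.add_right_inj ?_).1 h2
  rw [← h1] at hfin
  exact hfin

end IsCenteredDiskMap

/-- The density is that of `greenMeasure f` times a function of f(z), so the image is a fixed weight
times the image of `greenMeasure f`. The latter is independent of f and may be computed with the
identity. -/
theorem IsCenteredInnerMap.map_potentialMeasure {f : ℂ → ℂ} (hf : IsCenteredInnerMap f) :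
    (potentialMeasure (pullbackDensity f)).map f = heightMeasure := by
  have key : ∀ {f : ℂ → ℂ}, IsCenteredInnerMap f →
      (potentialMeasure (pullbackDensity f)).map f = ((greenMeasure f).map f).withDensity
        fun w => ENNReal.ofReal (2 / Real.pi) * ENNReal.ofReal (1 / (1 - ‖w‖ ^ 2) ^ 2) := by
    intro f hf
    have hm : Measurable fun w : ℂ =>
        ENNReal.ofReal (2 / Real.pi) * ENNReal.ofReal (1 / (1 - ‖w‖ ^ 2) ^ 2) := by fun_prop
    have hgr : Measurable fun z => greenWeight 1 z * ‖deriv f z‖ₑ ^ 2 :=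
      (measurable_greenWeight 1).mul ((measurable_deriv f).enorm.pow_const 2)
    ext s hs
    rw [Measure.map_apply hf.measurable hs, withDensity_apply _ hs,
      setLIntegral_map hs hm hf.measurable, potentialMeasure_apply, greenMeasure,
      restrict_withDensity (hf.measurable hs), lintegral_withDensity_eq_lintegral_mul _ hgr
        (g := fun z => ENNReal.ofReal (2 / Real.pi) * ENNReal.ofReal (1 / (1 - ‖f z‖ ^ 2) ^ 2))
        (hm.comp hf.measurable)]
    refine lintegral_congr fun z => ?_
    simp only [Pi.mul_apply, pullbackDensity]
    ring
  rw [key hf, hf.map_greenMeasure_eq isCenteredInnerMap_diskId, ← key isCenteredInnerMap_diskId,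
    ← heightMeasure]
  refine (Measure.map_congr ?_).trans Measure.map_id
  have : ∀ᵐ z ∂heightMeasure, z ∈ ball (0 : ℂ) 1 :=
    (withDensity_absolutelyContinuous _ _) (ae_restrict_mem measurableSet_ball)
  filter_upwards [this] with z hz
  exact diskId_apply (by simpa using hz)

theorem IsCenteredInnerMap.map_heightMeasure {f : ℂ → ℂ} (hf : IsCenteredInnerMap f) :
    heightMeasure.map f = heightMeasure + (defectMeasure f).map f := by
  conv_lhs => rw [hf.heightMeasure_eq_add]
  rw [Measure.map_add _ _ hf.measurable, hf.map_potentialMeasure]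

/-! ### Radial limits and the total mass of the defect -/

namespace IsCenteredDiskMap

variable {f : ℂ → ℂ}

theorem norm_circleMap_lt_one {r : ℝ} (hr : r ∈ Ioo (0 : ℝ) 1) (θ : ℝ) :
    ‖circleMap 0 r θ‖ = r ∧ circleMap 0 r θ ∈ ball (0 : ℂ) 1 := by
  have : ‖circleMap 0 r θ‖ = r := by simp [abs_of_pos hr.1]
  exact ⟨this, by rw [mem_ball_zero_iff, this]; exact hr.2⟩

theorem hasDerivAt_ray (hf : IsCenteredDiskMap f) {r : ℝ} (hr : r ∈ Ioo (0 : ℝ) 1) (θ : ℝ) :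
    HasDerivAt (fun t : ℝ => f (circleMap 0 t θ))
      (deriv f (circleMap 0 r θ) * Complex.exp (θ * Complex.I)) r := by
  have h1 : HasDerivAt (fun t : ℝ => circleMap 0 t θ) (Complex.exp (θ * Complex.I)) r := by
    have := (Complex.ofRealCLM.hasDerivAt (x := r)).mul_const (Complex.exp (θ * Complex.I))
    simpa [circleMap] using this
  exact (hf.differentiableOn.differentiableAt
    (isOpen_ball.mem_nhds (norm_circleMap_lt_one hr θ).2)).hasDerivAt.comp_of_eq r h1 rfl

/-- By Schwarz–Pick the numerator of the derivative is at least 2(1-|f|²)(r-|f|), which is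
nonnegative by Schwarz's lemma. -/
theorem monotoneOn_ray (hf : IsCenteredDiskMap f) (θ : ℝ) :
    MonotoneOn (fun r : ℝ => (1 - ‖f (circleMap 0 r θ)‖ ^ 2) / (1 - r ^ 2)) (Ioo 0 1) := by
  have hder : ∀ r ∈ Ioo (0 : ℝ) 1, HasDerivAt
      (fun r : ℝ => (1 - ‖f (circleMap 0 r θ)‖ ^ 2) / (1 - r ^ 2))
      (((-(2 * inner ℝ (f (circleMap 0 r θ))
        (deriv f (circleMap 0 r θ) * Complex.exp (θ * Complex.I)))) * (1 - r ^ 2) -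
        (1 - ‖f (circleMap 0 r θ)‖ ^ 2) * (-(2 * r))) / (1 - r ^ 2) ^ 2) r := by
    intro r hr
    have h1 := ((hf.hasDerivAt_ray hr θ).norm_sq).const_sub 1
    have h2 : HasDerivAt (fun r : ℝ => 1 - r ^ 2) (-(2 * r)) r := by
      simpa using (hasDerivAt_pow 2 r).const_sub 1
    exact h1.div h2 (by nlinarith [hr.1, hr.2])
  refine monotoneOn_of_deriv_nonneg (convex_Ioo 0 1)
    (fun r hr => (hder r hr).continuousAt.continuousWithinAt)
    (fun r hr => (hder r (interior_subset hr)).differentiableAt.differentiableWithinAt) ?_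
  intro r hr
  rw [interior_Ioo] at hr
  rw [(hder r hr).deriv]
  refine div_nonneg ?_ (by positivity)
  obtain ⟨hn, hmem⟩ := norm_circleMap_lt_one hr θ
  set z := circleMap 0 r θ
  have h1 := hf.schwarzPick (z := z) (by rw [hn]; exact hr.2)
  have h2 := hf.norm_le_norm z
  have h3 : inner ℝ (f z) (deriv f z * Complex.exp (θ * Complex.I)) ≤ ‖f z‖ * ‖deriv f z‖ := by
    refine (real_inner_le_norm _ _).trans ?_
    rw [norm_mul, Complex.norm_exp_ofReal_mul_I, mul_one]
  rw [hn] at h1 h2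
  have h4 : 0 < 1 - r ^ 2 := by nlinarith [hr.1, hr.2]
  have h5 := mul_le_mul_of_nonneg_right h3 h4.le
  have h6 := mul_le_mul_of_nonneg_left h1 (norm_nonneg (f z))
  have h7 := mul_le_mul_of_nonneg_right h2 (hf.one_sub_sq_pos z).le
  nlinarith

/-- Schwarz–Pick bounds the quotient below by |f'|. For the upper bound, if |f'| ≤ M near the end of
the ray, then 1-|f| ≤ |η-f| ≤ M(1-r), so the quotient is at most 2M/(1+r), which tends to M. -/
theorem tendsto_ray (hf : IsCenteredDiskMap f) {θ : ℝ} {η d : ℂ} (hη : ‖η‖ = 1)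
    (hfη : Tendsto (fun r : ℝ => f (circleMap 0 r θ)) (𝓝[<] 1) (𝓝 η))
    (hd : Tendsto (fun r : ℝ => deriv f (circleMap 0 r θ)) (𝓝[<] 1) (𝓝 d)) :
    Tendsto (fun r : ℝ => (1 - ‖f (circleMap 0 r θ)‖ ^ 2) / (1 - r ^ 2)) (𝓝[<] 1) (𝓝 ‖d‖) := by
  have hIoo : ∀ᶠ r in 𝓝[<] (1 : ℝ), r ∈ Ioo (0 : ℝ) 1 := Ioo_mem_nhdsLT one_pos
  rw [tendsto_order]
  constructor
  · intro a ha
    filter_upwards [hIoo, hd.norm.eventually_const_lt ha] with r hr h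
    obtain ⟨hn, hmem⟩ := norm_circleMap_lt_one hr θ
    have h1 := hf.schwarzPick (z := circleMap 0 r θ) (by rw [hn]; exact hr.2)
    rw [hn] at h1
    exact h.trans_le ((le_div_iff₀ (by nlinarith [hr.1, hr.2])).2 h1)
  · intro a ha
    obtain ⟨M, hM1, hM2⟩ := exists_between ha
    obtain ⟨ρ, hρ, hsub⟩ := (mem_nhdsLT_iff_exists_Ioo_subset).1
      (hIoo.and (hd.norm.eventually_lt_const hM1))
    have hlim : Tendsto (fun r : ℝ => 2 * M / (1 + r)) (𝓝[<] 1) (𝓝 M) := by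
      have : Tendsto (fun r : ℝ => 2 * M / (1 + r)) (𝓝 1) (𝓝 (2 * M / (1 + 1))) :=
        tendsto_const_nhds.div (tendsto_const_nhds.add tendsto_id) (by norm_num)
      rw [show 2 * M / (1 + 1) = M by ring] at this
      exact this.mono_left nhdsWithin_le_nhds
    filter_upwards [Ioo_mem_nhdsLT hρ, hlim.eventually_lt_const hM2] with r hr h
    refine lt_of_le_of_lt ?_ h
    have hr01 := (hsub hr).1
    have hbound : ∀ s ∈ Ioo r 1, ‖f (circleMap 0 s θ) - f (circleMap 0 r θ)‖ ≤ M * (1 - r) := by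
      intro s hs
      have := (convex_Ioo ρ 1).norm_image_sub_le_of_norm_hasDerivWithin_le (C := M)
        (fun t ht => (hf.hasDerivAt_ray (hsub ht).1 θ).hasDerivWithinAt)
        (fun t ht => by
          rw [norm_mul, Complex.norm_exp_ofReal_mul_I, mul_one]
          exact (hsub ht).2.le) hr ⟨hr.1.trans hs.1, hs.2⟩
      refine this.trans ?_
      have hM0 : 0 ≤ M := (norm_nonneg d).trans hM1.le
      rw [Real.norm_of_nonneg (by linarith [hs.1])]
      exact mul_le_mul_of_nonneg_left (by linarith [hs.2]) hM0
    have hηb : ‖η - f (circleMap 0 r θ)‖ ≤ M * (1 - r) := by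
      refine le_of_tendsto (hfη.sub_const _).norm ?_
      filter_upwards [Ioo_mem_nhdsLT hr01.2] with s hs using hbound s hs
    have h1 : 1 - ‖f (circleMap 0 r θ)‖ ≤ M * (1 - r) := by
      have := (norm_sub_norm_le η (f (circleMap 0 r θ))).trans hηb
      rwa [hη] at this
    have h2 := hf.norm_lt_one (circleMap 0 r θ)
    have h3 := norm_nonneg (f (circleMap 0 r θ))
    rw [div_le_div_iff₀ (by nlinarith [hr01.1, hr01.2]) (by linarith [hr01.1])]
    have h4 : 1 - ‖f (circleMap 0 r θ)‖ ^ 2 ≤ 2 * (M * (1 - r)) := by nlinarith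
    nlinarith [mul_le_mul_of_nonneg_right h4 (show 0 ≤ 1 + r by linarith [hr01.1])]

theorem one_le_ray (hf : IsCenteredDiskMap f) {r : ℝ} (hr : r ∈ Ioo (0 : ℝ) 1) (θ : ℝ) :
    1 ≤ (1 - ‖f (circleMap 0 r θ)‖ ^ 2) / (1 - r ^ 2) := by
  have h := hf.norm_le_norm (circleMap 0 r θ)
  rw [(norm_circleMap_lt_one hr θ).1] at h
  have := pow_le_pow_left₀ (norm_nonneg _) h 2
  rw [le_div_iff₀ (by nlinarith [hr.1, hr.2])]
  linarith

theorem one_le_norm_of_tendsto (hf : IsCenteredDiskMap f) {θ : ℝ} {η d : ℂ} (hη : ‖η‖ = 1)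
    (hfη : Tendsto (fun r : ℝ => f (circleMap 0 r θ)) (𝓝[<] 1) (𝓝 η))
    (hd : Tendsto (fun r : ℝ => deriv f (circleMap 0 r θ)) (𝓝[<] 1) (𝓝 d)) : 1 ≤ ‖d‖ := by
  refine ge_of_tendsto (hf.tendsto_ray hη hfη hd) ?_
  filter_upwards [Ioo_mem_nhdsLT one_pos] with r hr using hf.one_le_ray hr θ

/-- The total mass of the defect is the mean of the logarithm of the angular derivative. -/
theorem defectMeasure_univ (hf : IsCenteredDiskMap f) {d : ℝ → ℂ}
    (hd : ∀ᵐ θ : ℝ, (∃ η : ℂ, ‖η‖ = 1 ∧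
      Tendsto (fun r : ℝ => f (circleMap 0 r θ)) (𝓝[<] 1) (𝓝 η)) ∧
      Tendsto (fun r : ℝ => deriv f (circleMap 0 r θ)) (𝓝[<] 1) (𝓝 (d θ))) :
    defectMeasure f univ = ENNReal.ofReal (1 / (2 * Real.pi)) *
      ∫⁻ θ in Ioo (-Real.pi) Real.pi, ENNReal.ofReal (Real.log ‖d θ‖) := by
  have hρ : ∀ n, exhaustionRadius n ∈ Ioo (0 : ℝ) 1 := fun n =>
    ⟨exhaustionRadius_pos n, exhaustionRadius_lt_one n⟩
  have h1 : Tendsto (fun n => 4 * ∫⁻ z in ball 0 1,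
      greenWeight (exhaustionRadius n) z * defectDensity f z) atTop
      (𝓝 (4 * ∫⁻ z in ball 0 1, greenWeight 1 z * defectDensity f z)) :=
    ENNReal.Tendsto.const_mul (tendsto_lintegral_greenWeight_mul
      (measurable_defectDensity hf.measurable)) (Or.inr (by simp))
  have h2 : Tendsto (fun n => ∫⁻ θ in Ioo (-Real.pi) Real.pi, ENNReal.ofReal (Real.log
      ((1 - ‖f (circleMap 0 (exhaustionRadius n) θ)‖ ^ 2) / (1 - exhaustionRadius n ^ 2)))) atTop
      (𝓝 (∫⁻ θ in Ioo (-Real.pi) Real.pi, ENNReal.ofReal (Real.log ‖d θ‖))) := by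
    refine lintegral_tendsto_of_tendsto_of_monotone (fun n => ?_) ?_ ?_
    · have : Measurable fun θ => f (circleMap 0 (exhaustionRadius n) θ) :=
        hf.measurable.comp (continuous_circleMap 0 _).measurable
      exact (Real.measurable_log.comp
        (((this.norm.pow_const 2).const_sub 1).div_const _)).ennreal_ofReal.aemeasurable
    · refine Eventually.of_forall fun θ m n hmn => ENNReal.ofReal_le_ofReal ?_
      refine Real.log_le_log (one_pos.trans_le (hf.one_le_ray (hρ m) θ)) ?_
      exact hf.monotoneOn_ray θ (hρ m) (hρ n) (exhaustionRadius_monotone hmn)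
    · refine ae_restrict_of_ae (hd.mono fun θ hθ => ?_)
      obtain ⟨⟨η, hη, hfη⟩, hdθ⟩ := hθ
      have hpos := hf.one_le_norm_of_tendsto hη hfη hdθ
      refine ENNReal.tendsto_ofReal ?_
      refine (Real.continuousAt_log (by linarith)).tendsto.comp ?_
      exact (hf.tendsto_ray hη hfη hdθ).comp tendsto_exhaustionRadius_nhdsLT
  have h3 : 4 * ∫⁻ z in ball 0 1, greenWeight 1 z * defectDensity f z =
      ∫⁻ θ in Ioo (-Real.pi) Real.pi, ENNReal.ofReal (Real.log ‖d θ‖) := by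
    refine tendsto_nhds_unique h1 (h2.congr fun n => ?_)
    rw [hf.four_mul_lintegral_defectDensity (hρ n).1 (hρ n).2, circleLIntegral]
    refine lintegral_congr fun θ => ?_
    rw [(norm_circleMap_lt_one (hρ n) θ).1]
  have hm : Measurable fun z => greenWeight 1 z * defectDensity f z :=
    (measurable_greenWeight 1).mul (measurable_defectDensity hf.measurable)
  rw [defectMeasure, potentialMeasure_apply, Measure.restrict_univ, lintegral_const_mul _ hm, ← h3,
    ← mul_assoc, show (4 : ENNReal) = ENNReal.ofReal 4 by simp, ← ENNReal.ofReal_mul (by positivity)]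
  congr 2
  field_simp
  norm_num

end IsCenteredDiskMap

/-! ### The defect of `F` and the Lyapunov exponent -/

namespace CenteredInnerFunction

/-- The map `F`, extended by zero outside the unit disk. -/
noncomputable def diskMap (F : CenteredInnerFunction) : ℂ → ℂ := (ball (0 : ℂ) 1).indicator F

theorem diskMap_apply (F : CenteredInnerFunction) {z : ℂ} (hz : z ∈ ball (0 : ℂ) 1) :
    F.diskMap z = F z := indicator_of_mem hz _

theorem diskMap_eventuallyEq (F : CenteredInnerFunction) {z : ℂ} (hz : z ∈ ball (0 : ℂ) 1) :
    F.diskMap =ᶠ[𝓝 z] F := by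
  filter_upwards [isOpen_ball.mem_nhds hz] with w hw using F.diskMap_apply hw

theorem circleMap_mem_ball_eventually (θ : ℝ) :
    ∀ᶠ r in 𝓝[<] (1 : ℝ), circleMap 0 r θ ∈ ball (0 : ℂ) 1 := by
  filter_upwards [Ioo_mem_nhdsLT one_pos] with r hr
  exact (IsCenteredDiskMap.norm_circleMap_lt_one hr θ).2

theorem ofReal_mul_circleMap (r θ : ℝ) : (r : ℂ) * circleMap 0 1 θ = circleMap 0 r θ := by
  simp [circleMap]

theorem isCenteredInnerMap_diskMap (F : CenteredInnerFunction) : IsCenteredInnerMap F.diskMap where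
  toIsCenteredDiskMap := isCenteredDiskMap_indicator F.differentiableOn F.mapsTo F.map_zero
  ae_tendsto_norm := F.ae_radial_limit.mono fun θ ⟨η, hη, h⟩ => by
    simp only [ofReal_mul_circleMap] at h
    have h2 : Tendsto (fun r : ℝ => F.diskMap (circleMap 0 r θ)) (𝓝[<] 1) (𝓝 η) :=
      h.congr' ((circleMap_mem_ball_eventually θ).mono fun r hr => (F.diskMap_apply hr).symm)
    rw [← hη]
    exact h2.norm.comp tendsto_exhaustionRadius_nhdsLT

theorem defectMeasure_univ (F : CenteredInnerFunction) (hF : F.FiniteLyapunovExponent) :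
    defectMeasure F.diskMap univ = ENNReal.ofReal F.lyapunovExponent ∧ 0 ≤ F.lyapunovExponent := by
  have hc := F.isCenteredInnerMap_diskMap.toIsCenteredDiskMap
  have hd : ∀ᵐ θ : ℝ, (∃ η : ℂ, ‖η‖ = 1 ∧
      Tendsto (fun r : ℝ => F.diskMap (circleMap 0 r θ)) (𝓝[<] 1) (𝓝 η)) ∧
      Tendsto (fun r : ℝ => deriv F.diskMap (circleMap 0 r θ)) (𝓝[<] 1)
        (𝓝 (F.angularDerivative (circleMap 0 1 θ))) := by
    filter_upwards [hF.1] with θ hθ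
    obtain ⟨⟨η, hη, h⟩, hlim⟩ := hθ
    have hlim' := tendsto_nhds_limUnder hlim
    simp only [ofReal_mul_circleMap] at h hlim'
    refine ⟨⟨η, hη, h.congr' ?_⟩, ?_⟩
    · exact (circleMap_mem_ball_eventually θ).mono fun r hr => (F.diskMap_apply hr).symm
    · simp only [angularDerivative, ofReal_mul_circleMap]
      exact hlim'.congr' ((circleMap_mem_ball_eventually θ).mono fun r hr =>
        (F.diskMap_eventuallyEq hr).deriv_eq.symm)
  have hnonneg : ∀ᵐ θ : ℝ, 0 ≤ Real.log ‖F.angularDerivative (circleMap 0 1 θ)‖ := by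
    filter_upwards [hd] with θ hθ
    obtain ⟨⟨η, hη, h⟩, hlim⟩ := hθ
    exact Real.log_nonneg (hc.one_le_norm_of_tendsto hη h hlim)
  constructor
  · rw [hc.defectMeasure_univ hd]
    have := circleLIntegral_ofReal hF.2 hnonneg
    rw [circleLIntegral] at this
    rw [this, ← ENNReal.ofReal_mul (by positivity), lyapunovExponent]
    congr 1
    field_simp
  · rw [lyapunovExponent, Real.circleAverage]
    refine smul_nonneg (by positivity) ?_
    exact intervalIntegral.integral_nonneg_of_ae (by positivity) hnonneg

end CenteredInnerFunction

/-! ### Local finiteness and contraction under iteration -/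

theorem measure_ball_compl_potentialMeasure (ρ : ℂ → ENNReal) :
    ∀ᵐ z ∂potentialMeasure ρ, z ∈ ball (0 : ℂ) 1 :=
  (withDensity_absolutelyContinuous _ _) (ae_restrict_mem measurableSet_ball)

theorem heightMeasure_singleton (z : ℂ) : heightMeasure {z} = 0 :=
  (withDensity_absolutelyContinuous _ _) (measure_singleton z)

/-- The hyperbolic density is bounded on the smaller disk, and the logarithmic singularity at 0 is
integrable because the Green measure of the identity is finite. -/
theorem heightMeasure_ball_lt_top {r : ℝ} (hr : 0 < r) (hr1 : r < 1) :
    heightMeasure (ball 0 r) < ⊤ := by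
  have hfin := isCenteredInnerMap_diskId.greenMeasure_univ_ne_top
  have hc : 0 < 1 - r ^ 2 := by nlinarith
  set C : ENNReal := ENNReal.ofReal (2 / Real.pi) * ENNReal.ofReal (1 / (1 - r ^ 2) ^ 2)
  have hle : heightMeasure (ball 0 r) ≤ C * greenMeasure diskId univ := by
    have hm : Measurable fun z => greenWeight 1 z * ‖deriv diskId z‖ₑ ^ 2 :=
      (measurable_greenWeight 1).mul ((measurable_deriv _).enorm.pow_const 2)
    rw [heightMeasure, potentialMeasure_apply, greenMeasure, withDensity_apply' _ univ,
      Measure.restrict_univ, ← lintegral_const_mul _ hm,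
      Measure.restrict_restrict measurableSet_ball]
    refine (setLIntegral_mono' (measurableSet_ball.inter measurableSet_ball) fun z hz => ?_).trans
      (lintegral_mono_set inter_subset_right)
    rw [pullbackDensity, diskId_apply (by simpa using hz.2), mul_assoc]
    refine mul_le_mul_right ?_ _
    rw [← mul_assoc, mul_comm]
    refine mul_le_mul_left (ENNReal.ofReal_le_ofReal ?_) _
    have hz1 : ‖z‖ < r := by simpa using hz.1
    have : ‖z‖ ^ 2 ≤ r ^ 2 := pow_le_pow_left₀ (norm_nonneg _) hz1.le 2
    gcongr
  exact hle.trans_lt (ENNReal.mul_lt_top (ENNReal.mul_lt_top ENNReal.ofReal_lt_top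
    ENNReal.ofReal_lt_top) hfin.lt_top)

namespace IsCenteredDiskMap

variable {f : ℂ → ℂ}

theorem measurable_iterate (hf : IsCenteredDiskMap f) (n : ℕ) : Measurable f^[n] :=
  hf.measurable.iterate n

theorem norm_iterate_le (hf : IsCenteredDiskMap f) (n : ℕ) (z : ℂ) : ‖f^[n] z‖ ≤ ‖z‖ := by
  induction n with
  | zero => simp
  | succ n ih =>
    rw [Function.iterate_succ_apply']
    exact (hf.norm_le_norm _).trans ih

/-- A centered disk map that is not a rotation is a strict contraction on compact sets. -/
theorem exists_norm_le_mul_norm (hf : IsCenteredDiskMap f)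
    (hnr : ¬ ∃ c : ℂ, ‖c‖ = 1 ∧ ∀ z ∈ ball (0 : ℂ) 1, f z = c * z) {r : ℝ} (hr : 0 ≤ r)
    (hr1 : r < 1) : ∃ q, 0 ≤ q ∧ q < 1 ∧ ∀ z, ‖z‖ ≤ r → ‖f z‖ ≤ q * ‖z‖ := by
  have hmaps : MapsTo f (ball 0 1) (closedBall (f 0) 1) := fun z _ => by
    rw [hf.map_zero, mem_closedBall_zero_iff]
    exact (hf.norm_lt_one z).le
  -- The equality case of Schwarz's lemma: |f(z)/z| = 1 at one point (or |f'(0)| = 1) forces a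
  -- rotation. The constant q is the maximum of this modulus on a compact disk.
  have hlt : ∀ z ∈ ball (0 : ℂ) 1, ‖dslope f 0 z‖ < 1 := by
    intro z hz
    have hle := Complex.norm_dslope_le_div_of_mapsTo_ball hf.differentiableOn hmaps hz
    rw [div_one] at hle
    refine lt_of_le_of_ne hle fun heq => hnr ?_
    obtain ⟨c, hc, hfc⟩ := Complex.affine_of_mapsTo_ball_of_exists_norm_dslope_eq_div'
      hf.differentiableOn hmaps ⟨z, hz, by rw [heq, div_one]⟩
    refine ⟨c, by simpa using hc, fun w hw => ?_⟩
    have := hfc hw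
    simp only [hf.map_zero, zero_add, sub_zero, smul_eq_mul] at this
    rw [this, mul_comm]
  have hcont : ContinuousOn (fun z => ‖dslope f 0 z‖) (closedBall 0 r) := by
    refine ContinuousOn.norm (ContinuousOn.mono ?_ (closedBall_subset_ball hr1))
    have hnhds : ball (0 : ℂ) 1 ∈ 𝓝 (0 : ℂ) := ball_mem_nhds _ one_pos
    exact (continuousOn_dslope hnhds).2 ⟨hf.differentiableOn.continuousOn,
      hf.differentiableOn.differentiableAt hnhds⟩
  obtain ⟨w, hw, hmax⟩ := (isCompact_closedBall (0 : ℂ) r).exists_isMaxOn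
    ⟨0, mem_closedBall_self hr⟩ hcont
  refine ⟨‖dslope f 0 w‖, norm_nonneg _, hlt w (closedBall_subset_ball hr1 hw), fun z hz => ?_⟩
  have h := sub_smul_dslope f 0 z
  rw [hf.map_zero, sub_zero, sub_zero, smul_eq_mul] at h
  rw [← h, norm_mul, mul_comm]
  exact mul_le_mul_of_nonneg_right (hmax (by simpa using hz)) (norm_nonneg z)

theorem norm_iterate_le_pow (hf : IsCenteredDiskMap f) {q r : ℝ} (hq : 0 ≤ q)
    (h : ∀ z, ‖z‖ ≤ r → ‖f z‖ ≤ q * ‖z‖) {z : ℂ} (hz : ‖z‖ ≤ r) (n : ℕ) :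
    ‖f^[n] z‖ ≤ q ^ n * ‖z‖ := by
  induction n with
  | zero => simp
  | succ n ih =>
    rw [Function.iterate_succ_apply', pow_succ', mul_assoc]
    exact (h _ ((hf.norm_iterate_le n z).trans hz)).trans (mul_le_mul_of_nonneg_left ih hq)

theorem exists_norm_iterate_lt (hf : IsCenteredDiskMap f)
    (hnr : ¬ ∃ c : ℂ, ‖c‖ = 1 ∧ ∀ z ∈ ball (0 : ℂ) 1, f z = c * z) {r ε : ℝ} (hr : 0 ≤ r)
    (hr1 : r < 1) (hε : 0 < ε) : ∃ N, ∀ z, ‖z‖ ≤ r → ‖f^[N] z‖ < ε := by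
  obtain ⟨q, hq0, hq1, hq⟩ := hf.exists_norm_le_mul_norm hnr hr hr1
  obtain ⟨N, hN⟩ := exists_pow_lt_of_lt_one hε hq1
  refine ⟨N, fun z hz => ?_⟩
  refine (hf.norm_iterate_le_pow hq0 hq hz N).trans_lt (lt_of_le_of_lt ?_ hN)
  exact mul_le_of_le_one_right (by positivity) (hz.trans hr1.le)

theorem iUnion_preimage_iterate_ball (hf : IsCenteredDiskMap f)
    (hnr : ¬ ∃ c : ℂ, ‖c‖ = 1 ∧ ∀ z ∈ ball (0 : ℂ) 1, f z = c * z) {r : ℝ} (hr : 0 < r) :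
    ⋃ n, f^[n + 1] ⁻¹' ball 0 r = univ := by
  refine eq_univ_of_forall fun z => mem_iUnion.2 ?_
  -- z may lie outside the disk but f(z) never does; hence the exponent n + 1.
  obtain ⟨N, hN⟩ := hf.exists_norm_iterate_lt hnr (norm_nonneg (f z)) (hf.norm_lt_one z) hr
  exact ⟨N, by simpa using hN (f z) le_rfl⟩

theorem preimage_iterate_ball_mono (hf : IsCenteredDiskMap f) (r : ℝ) :
    Monotone fun n => f^[n + 1] ⁻¹' ball 0 r := by
  refine monotone_nat_of_le_succ fun n z hz => ?_
  simp only [mem_preimage, mem_ball_zero_iff] at hz ⊢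
  rw [Function.iterate_succ_apply']
  exact (hf.norm_le_norm _).trans_lt hz

end IsCenteredDiskMap

/-! ### The invariant measure on the disk -/

/-- The `f`-invariant measure on the disk obtained as the limit of the images of `heightMeasure`
under the iterates of `f`. -/
noncomputable def invariantMeasure (f : ℂ → ℂ) : Measure ℂ :=
  heightMeasure + Measure.sum fun n => (defectMeasure f).map f^[n + 1]

namespace IsCenteredInnerMap

variable {f : ℂ → ℂ}

theorem map_iterate_heightMeasure (hf : IsCenteredInnerMap f) (n : ℕ) :
    heightMeasure.map f^[n] =
      heightMeasure + ∑ k ∈ Finset.range n, (defectMeasure f).map f^[k + 1] := by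
  induction n with
  | zero => simp
  | succ n ih =>
    rw [Function.iterate_succ, ← Measure.map_map (hf.measurable_iterate n) hf.measurable,
      hf.map_heightMeasure, Measure.map_add _ _ (hf.measurable_iterate n), ih,
      Measure.map_map (hf.measurable_iterate n) hf.measurable, Finset.sum_range_succ, add_assoc]
    rfl

theorem tendsto_map_iterate (hf : IsCenteredInnerMap f) {A : Set ℂ} (hA : MeasurableSet A) :
    Tendsto (fun n => heightMeasure.map f^[n] A) atTop (𝓝 (invariantMeasure f A)) := by
  simp only [hf.map_iterate_heightMeasure, invariantMeasure, Measure.add_apply,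
    Measure.sum_apply _ hA, Measure.coe_finsetSum, Finset.sum_apply]
  exact tendsto_const_nhds.add (ENNReal.tendsto_nat_tsum _)

/-- Pushing forward shifts the series by one, and the term lost is exactly what the image of
`heightMeasure` gains. -/
theorem map_invariantMeasure (hf : IsCenteredInnerMap f) :
    (invariantMeasure f).map f = invariantMeasure f := by
  have hms : (Measure.sum fun n => (defectMeasure f).map f^[n + 1]).map f =
      Measure.sum fun n => (defectMeasure f).map f^[n + 2] := by
    rw [Measure.map_sum hf.measurable.aemeasurable]
    congr 1
    funext n
    rw [Measure.map_map hf.measurable (hf.measurable_iterate _), ← Function.iterate_succ']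
  ext s hs
  rw [invariantMeasure, Measure.map_add _ _ hf.measurable, hms, hf.map_heightMeasure]
  simp only [Measure.add_apply, Measure.sum_apply _ hs]
  rw [add_assoc, tsum_eq_zero_add' (f := fun n => (defectMeasure f).map f^[n + 1] s)
    ENNReal.summable]
  simp

/-- The zeros of f' are isolated unless f is constant, hence zero, which contradicts unimodular
boundary values. -/
theorem deriv_ne_zero_ae (hf : IsCenteredInnerMap f) :
    ∀ᵐ z ∂volume.restrict (ball (0 : ℂ) 1), deriv f z ≠ 0 := by
  have han : AnalyticOnNhd ℂ (deriv f) (ball 0 1) :=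
    (hf.differentiableOn.deriv isOpen_ball).analyticOnNhd isOpen_ball
  have hconn : IsPreconnected (ball (0 : ℂ) 1) := (convex_ball _ _).isPreconnected
  rcases han.eqOn_zero_or_eventually_ne_zero_of_preconnected hconn with h | h
  · exfalso
    have hzero : ∀ z ∈ ball (0 : ℂ) 1, f z = 0 := fun z hz => by
      rw [isOpen_ball.is_const_of_deriv_eq_zero hconn hf.differentiableOn h hz
        (mem_ball_self one_pos), hf.map_zero]
    obtain ⟨θ, hθ⟩ := hf.ae_tendsto_norm.exists
    have h0 : ∀ n, ‖f (circleMap 0 (exhaustionRadius n) θ)‖ = 0 := fun n => by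
      rw [hzero _ (IsCenteredDiskMap.norm_circleMap_lt_one
        ⟨exhaustionRadius_pos n, exhaustionRadius_lt_one n⟩ θ).2, norm_zero]
    simp only [h0] at hθ
    exact zero_ne_one (tendsto_nhds_unique tendsto_const_nhds hθ)
  · exact ae_restrict_le_codiscreteWithin measurableSet_ball h

/-- The pulled-back density is positive almost everywhere, which makes preimages of null sets null.
-/
theorem heightMeasure_absolutelyContinuous (hf : IsCenteredInnerMap f) :
    heightMeasure ≪ potentialMeasure (pullbackDensity f) := by
  refine (withDensity_absolutelyContinuous _ _).trans ?_
  refine withDensity_absolutelyContinuous' ?_ ?_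
  · exact (((measurable_greenWeight 1).mul
      (measurable_pullbackDensity hf.measurable)).const_mul _).aemeasurable
  · filter_upwards [hf.deriv_ne_zero_ae, ae_restrict_of_ae (Measure.ae_ne volume 0),
      ae_restrict_mem measurableSet_ball] with z h1 h2 h3
    have h4 := norm_pos_iff.2 h2
    have h5 := hf.one_sub_sq_pos z
    have h6 : ‖z‖ < 1 := by simpa using h3
    refine mul_ne_zero ?_ (mul_ne_zero ?_ (mul_ne_zero (pow_ne_zero 2 (enorm_ne_zero.2 h1)) ?_))
    · simp [Real.pi_pos]
    · rw [greenWeight, Ne, ENNReal.ofReal_eq_zero, not_le]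
      exact Real.log_pos ((one_lt_div h4).2 h6)
    · rw [Ne, ENNReal.ofReal_eq_zero, not_le]
      positivity

theorem heightMeasure_preimage_eq_zero (hf : IsCenteredInnerMap f) {s : Set ℂ}
    (hs : MeasurableSet s) (h : heightMeasure s = 0) : heightMeasure (f ⁻¹' s) = 0 := by
  refine hf.heightMeasure_absolutelyContinuous ?_
  rw [← Measure.map_apply hf.measurable hs, hf.map_potentialMeasure, h]

theorem heightMeasure_preimage_iterate_eq_zero (hf : IsCenteredInnerMap f) (n : ℕ) {s : Set ℂ}
    (hs : MeasurableSet s) (h : heightMeasure s = 0) : heightMeasure (f^[n] ⁻¹' s) = 0 := by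
  induction n generalizing s with
  | zero => simpa using h
  | succ n ih =>
    rw [Function.iterate_succ', preimage_comp]
    exact ih (hf.measurable hs) (hf.heightMeasure_preimage_eq_zero hs h)

/-- Rules out an atom at the fixed point, so that almost every backward orbit avoids 0. -/
theorem invariantMeasure_singleton_zero (hf : IsCenteredInnerMap f) :
    invariantMeasure f {0} = 0 := by
  refine tendsto_nhds_unique (hf.tendsto_map_iterate (measurableSet_singleton 0)) ?_
  refine tendsto_const_nhds.congr fun n => ?_
  rw [Measure.map_apply (hf.measurable_iterate n) (measurableSet_singleton 0),
    hf.heightMeasure_preimage_iterate_eq_zero n (measurableSet_singleton 0)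
      (heightMeasure_singleton 0)]

theorem invariantMeasure_compl_ball (hf : IsCenteredInnerMap f) :
    invariantMeasure f (ball 0 1)ᶜ = 0 := by
  have h : (f ⁻¹' (ball (0 : ℂ) 1)ᶜ) = ∅ := by
    ext z
    simpa using hf.norm_lt_one z
  rw [← hf.map_invariantMeasure, Measure.map_apply hf.measurable measurableSet_ball.compl, h,
    measure_empty]

theorem map_iterate_heightMeasure_ball_ne_top (hf : IsCenteredInnerMap f)
    (hfin : defectMeasure f univ ≠ ⊤) {r : ℝ} (hr : 0 < r) (hr1 : r < 1) (n : ℕ) :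
    heightMeasure.map f^[n] (ball 0 r) ≠ ⊤ := by
  rw [hf.map_iterate_heightMeasure, Measure.add_apply, Measure.coe_finsetSum, Finset.sum_apply]
  refine ENNReal.add_ne_top.2 ⟨(heightMeasure_ball_lt_top hr hr1).ne, ?_⟩
  refine ENNReal.sum_ne_top.2 fun k _ => ?_
  rw [Measure.map_apply (hf.measurable_iterate _) measurableSet_ball]
  exact ne_top_of_le_ne_top hfin (measure_mono (subset_univ _))

/-- The disk lies in its preimage, so the mass is a difference of consecutive iterates on the disk,
namely the last term of the telescoping sum. The subtraction needs a finite mass. -/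
theorem map_iterate_heightMeasure_sdiff (hf : IsCenteredInnerMap f)
    (hfin : defectMeasure f univ ≠ ⊤) {r : ℝ} (hr : 0 < r) (hr1 : r < 1) (n : ℕ) :
    heightMeasure.map f^[n] (f ⁻¹' ball 0 r \ ball 0 r) =
      defectMeasure f (f^[n + 1] ⁻¹' ball 0 r) := by
  have hfinn := hf.map_iterate_heightMeasure_ball_ne_top hfin hr hr1 n
  have hsub : ball (0 : ℂ) r ⊆ f ⁻¹' ball 0 r := fun z hz => by
    simp only [mem_preimage, mem_ball_zero_iff] at hz ⊢
    exact (hf.norm_le_norm z).trans_lt hz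
  rw [measure_sdiff hsub measurableSet_ball.nullMeasurableSet hfinn,
    ← Measure.map_apply hf.measurable measurableSet_ball,
    Measure.map_map hf.measurable (hf.measurable_iterate n), ← Function.iterate_succ',
    hf.map_iterate_heightMeasure (n + 1), Finset.sum_range_succ, ← add_assoc,
    ← hf.map_iterate_heightMeasure n, Measure.add_apply, ENNReal.add_sub_cancel_left hfinn,
    Measure.map_apply (hf.measurable_iterate _) measurableSet_ball]

/-- The invariant measure of a fundamental annulus is the total mass of the defect. -/
theorem invariantMeasure_preimage_ball_sdiff (hf : IsCenteredInnerMap f)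
    (hnr : ¬ ∃ c : ℂ, ‖c‖ = 1 ∧ ∀ z ∈ ball (0 : ℂ) 1, f z = c * z)
    (hfin : defectMeasure f univ ≠ ⊤) {r : ℝ} (hr : 0 < r) (hr1 : r < 1) :
    invariantMeasure f (f ⁻¹' ball 0 r \ ball 0 r) = defectMeasure f univ := by
  refine tendsto_nhds_unique (hf.tendsto_map_iterate
    ((hf.measurable measurableSet_ball).diff measurableSet_ball)) ?_
  simp only [hf.map_iterate_heightMeasure_sdiff hfin hr hr1]
  rw [← hf.iUnion_preimage_iterate_ball hnr hr]
  exact tendsto_measure_iUnion_atTop (hf.preimage_iterate_ball_mono r)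

/-- All points of the annulus enter the disk of radius ε within N steps. Hence N iterated preimages
of the fundamental annulus cover it, each with the mass of the defect. -/
theorem invariantMeasure_annulus_lt_top (hf : IsCenteredInnerMap f)
    (hnr : ¬ ∃ c : ℂ, ‖c‖ = 1 ∧ ∀ z ∈ ball (0 : ℂ) 1, f z = c * z)
    (hfin : defectMeasure f univ ≠ ⊤) {ε r : ℝ} (hε : 0 < ε) (hr : 0 ≤ r) (hr1 : r < 1) :
    invariantMeasure f {z | ε ≤ ‖z‖ ∧ ‖z‖ ≤ r} < ⊤ := by
  rcases le_or_gt 1 ε with h1 | h1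
  · have : {z : ℂ | ε ≤ ‖z‖ ∧ ‖z‖ ≤ r} = ∅ := by
      ext z
      simp only [mem_ofPred_eq, mem_empty_iff_false, iff_false]
      intro h
      linarith [h.1, h.2]
    rw [this, measure_empty]
    exact ENNReal.zero_lt_top
  obtain ⟨N, hN⟩ := hf.exists_norm_iterate_lt hnr hr hr1 hε
  have hsub : {z | ε ≤ ‖z‖ ∧ ‖z‖ ≤ r} ⊆
      ⋃ j ∈ Finset.range N, f^[j] ⁻¹' (f ⁻¹' ball 0 ε \ ball 0 ε) := by
    intro z hz
    by_contra hcon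
    have hall : ∀ j ≤ N, ε ≤ ‖f^[j] z‖ := by
      intro j
      induction j with
      | zero => exact fun _ => hz.1
      | succ j ih =>
        intro hj
        by_contra hlt
        refine hcon (mem_biUnion (Finset.mem_coe.2 (Finset.mem_range.2 hj)) ?_)
        simp only [mem_preimage, Set.mem_sdiff, mem_ball_zero_iff, not_lt]
        rw [← Function.iterate_succ_apply' f]
        exact ⟨not_le.1 hlt, ih (by lia)⟩
    exact absurd (hN z hz.2) (not_lt.2 (hall N le_rfl))
  refine (measure_mono hsub).trans_lt ((measure_biUnion_finset_le _ _).trans_lt ?_)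
  refine ENNReal.sum_lt_top.2 fun j _ => ?_
  have hinv : (invariantMeasure f).map f^[j] = invariantMeasure f := by
    clear * - hf
    induction j with
    | zero => simp
    | succ j ih =>
      rw [Function.iterate_succ, ← Measure.map_map (hf.measurable_iterate j) hf.measurable,
        hf.map_invariantMeasure, ih]
  rw [← Measure.map_apply (hf.measurable_iterate j)
    ((hf.measurable measurableSet_ball).diff measurableSet_ball), hinv,
    hf.invariantMeasure_preimage_ball_sdiff hnr hfin hε h1]
  exact hfin.lt_top

end IsCenteredInnerMap

/-! ### Inverse limits and natural extensions -/

/-- An inverse system of finite measures on the Cantor space has an inverse limit. -/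
theorem exists_inverseLimit_cantor {f : (ℕ → Bool) → (ℕ → Bool)} (hf : Measurable f)
    (ρ : ℕ → Measure (ℕ → Bool)) [∀ n, IsFiniteMeasure (ρ n)]
    (h : ∀ n, (ρ (n + 1)).map f = ρ n) :
    ∃ ν : Measure (ℕ → ℕ → Bool), ∀ k,
      ν.map (fun z => (z k, z (k + 1))) = (ρ (k + 1)).map fun x => (f x, x) := by
  have hiter : ∀ n m, (ρ (n + m)).map f^[m] = ρ n := by
    intro n m
    induction m with
    | zero => simp
    | succ m ih =>
      rw [Function.iterate_succ, ← Measure.map_map (hf.iterate m) hf, ← add_assoc, h, ih]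
  have hφ : ∀ n, Measurable fun (x : ℕ → Bool) (k : ℕ) => f^[n - k] x := fun n =>
    measurable_pi_lambda _ fun k => hf.iterate (n - k)
  -- The law of the finite history (fⁿx, …, fx, x), with x distributed by `ρ n`. Truncated
  -- subtraction repeats x from coordinate n on.
  set N : ℕ → FiniteMeasure (ℕ → ℕ → Bool) := fun n =>
    FiniteMeasure.map ⟨ρ n, inferInstance⟩ fun x k => f^[n - k] x with hN
  have hmass : ∀ n, ρ n univ = ρ 0 univ := by
    intro n
    rw [← hiter 0 n, Measure.map_apply (hf.iterate n) MeasurableSet.univ, zero_add, preimage_univ]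
  have hmem : ∀ n, N n ∈ {μ : FiniteMeasure (ℕ → ℕ → Bool) | μ.mass ≤ (ρ 0 univ).toNNReal} := by
    intro n
    change (N n).mass ≤ (ρ 0 univ).toNNReal
    refine le_of_eq ?_
    rw [FiniteMeasure.mass, ← ENNReal.coe_inj, FiniteMeasure.ennreal_coeFn_eq_coeFn_toMeasure,
      ENNReal.coe_toNNReal (measure_ne_top _ _)]
    change (ρ n).map _ univ = _
    rw [Measure.map_apply (hφ n) MeasurableSet.univ, preimage_univ]
    exact hmass n
  -- Weak compactness of measures of bounded mass on a compact space gives a limit along an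
  -- ultrafilter.
  obtain ⟨ν, -, hν⟩ := (isCompact_setOfPred_finiteMeasure_le_of_compactSpace (ℕ → ℕ → Bool)
    (ρ 0 univ).toNNReal).ultrafilter_le_nhds' ((hyperfilter ℕ).map N)
    (Ultrafilter.mem_map.2 (Filter.Eventually.of_forall hmem))
  have hlim : Tendsto N (hyperfilter ℕ : Filter ℕ) (𝓝 ν) := hν
  refine ⟨ν, fun k => ?_⟩
  have hp : Continuous fun z : ℕ → ℕ → Bool => (z k, z (k + 1)) := by fun_prop
  have hg : Measurable fun x => (f x, x) := hf.prodMk measurable_id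
  have h1 : Tendsto (fun n => (N n).map fun z => (z k, z (k + 1))) (hyperfilter ℕ : Filter ℕ)
      (𝓝 (ν.map fun z => (z k, z (k + 1)))) :=
    ((FiniteMeasure.continuous_map hp).tendsto ν).comp hlim
  -- The joint law of two neighbouring coordinates is constant for n ≥ k + 1, so only projections,
  -- and never f itself, need to be continuous.
  have h2 : (fun n => (N n).map fun z => (z k, z (k + 1))) =ᶠ[(hyperfilter ℕ : Filter ℕ)]
      fun _ => FiniteMeasure.map ⟨ρ (k + 1), inferInstance⟩ fun x => (f x, x) := by
    refine Nat.hyperfilter_le_atTop ?_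
    filter_upwards [eventually_ge_atTop (k + 1)] with n hn
    obtain ⟨m, rfl⟩ := Nat.exists_eq_add_of_le hn
    apply Subtype.ext
    simp only [hN]
    change ((ρ (k + 1 + m)).map _).map _ = (ρ (k + 1)).map _
    rw [Measure.map_map hp.measurable (hφ _), ← hiter (k + 1) m, Measure.map_map hg (hf.iterate m)]
    congr 1
    funext x
    simp only [Function.comp_apply]
    rw [show k + 1 + m - k = m + 1 by lia, show k + 1 + m - (k + 1) = m by lia,
      Function.iterate_succ_apply']
  have h3 := tendsto_nhds_unique h1 (tendsto_const_nhds.congr' h2.symm)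
  exact congrArg (fun μ : FiniteMeasure ((ℕ → Bool) × (ℕ → Bool)) =>
    (μ : Measure ((ℕ → Bool) × (ℕ → Bool)))) h3

/-- An inverse system of finite measures on an uncountable standard Borel space has an inverse
limit. -/
theorem exists_inverseLimit {X : Type*} [MeasurableSpace X] [StandardBorelSpace X]
    (hX : ¬ Countable X) {f : X → X} (hf : Measurable f)
    (ρ : ℕ → Measure X) [∀ n, IsFiniteMeasure (ρ n)] (h : ∀ n, (ρ (n + 1)).map f = ρ n) :
    ∃ ν : Measure (ℕ → X), ∀ k,
      ν.map (fun z => (z k, z (k + 1))) = (ρ (k + 1)).map fun x => (f x, x) := by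
  set e : X ≃ᵐ (ℕ → Bool) := PolishSpace.measurableEquivNatBoolOfNotCountable hX
  obtain ⟨ν, hν⟩ := exists_inverseLimit_cantor (f := e ∘ f ∘ e.symm)
    (e.measurable.comp (hf.comp e.symm.measurable)) (fun n => (ρ n).map e) (fun n => by
      rw [Measure.map_map (e.measurable.comp (hf.comp e.symm.measurable)) e.measurable, ← h n,
        Measure.map_map e.measurable hf]
      congr 1
      funext x
      simp)
  have hm : Measurable fun (z : ℕ → ℕ → Bool) (n : ℕ) => e.symm (z n) :=
    measurable_pi_lambda _ fun n => e.symm.measurable.comp (measurable_pi_apply n)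
  refine ⟨ν.map fun z n => e.symm (z n), fun k => ?_⟩
  have hee : Measurable fun p : (ℕ → Bool) × (ℕ → Bool) => (e.symm p.1, e.symm p.2) :=
    (e.symm.measurable.comp measurable_fst).prodMk (e.symm.measurable.comp measurable_snd)
  have hg : Measurable fun x => ((e ∘ f ∘ e.symm) x, x) :=
    (e.measurable.comp (hf.comp e.symm.measurable)).prodMk measurable_id
  have h1 := congrArg (Measure.map fun p => (e.symm p.1, e.symm p.2)) (hν k)
  rw [Measure.map_map hee ((measurable_pi_apply k).prodMk (measurable_pi_apply (k + 1))),
    Measure.map_map hee hg, Measure.map_map (hee.comp hg) e.measurable] at h1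
  rw [Measure.map_map ((measurable_pi_apply k).prodMk (measurable_pi_apply (k + 1))) hm]
  refine h1.trans ?_
  congr 1
  funext x
  simp

/-- The natural extension of an invariant measure that is finite on a countable measurable
partition of a set. -/
theorem exists_naturalExtension {X : Type*} [MeasurableSpace X] [StandardBorelSpace X]
    (hX : ¬ Countable X) {f : X → X} (hf : Measurable f) {μ : Measure X} (hμ : μ.map f = μ)
    {A : ℕ → Set X} (hA : ∀ j, MeasurableSet (A j)) (hdisj : Pairwise (Function.onFun Disjoint A))
    (hfin : ∀ j, μ (A j) ≠ ⊤) :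
    ∃ ν : Measure (ℕ → X), (∀ k, ν.map (fun z => z k) = μ.restrict (f^[k] ⁻¹' ⋃ j, A j)) ∧
      ∀ k, ∀ᵐ z ∂ν, f (z (k + 1)) = z k := by
  have hpre : ∀ n {s}, MeasurableSet s → μ (f^[n] ⁻¹' s) = μ s := by
    intro n
    induction n with
    | zero => simp
    | succ n ih =>
      intro s hs
      rw [Function.iterate_succ, preimage_comp, ← Measure.map_apply hf (hf.iterate n hs), hμ, ih hs]
  -- By invariance the restrictions of μ to f^{-n}(A_j) form an inverse system of finite measures;
  -- summing the limits over j gives ν.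
  have key : ∀ j, ∃ ν : Measure (ℕ → X), ∀ k, ν.map (fun z => (z k, z (k + 1))) =
      (μ.restrict (f^[k + 1] ⁻¹' A j)).map fun x => (f x, x) := by
    intro j
    have : ∀ n, IsFiniteMeasure (μ.restrict (f^[n] ⁻¹' A j)) := fun n =>
      ⟨by rw [Measure.restrict_apply_univ, hpre n (hA j)]; exact (hfin j).lt_top⟩
    refine exists_inverseLimit hX hf (fun n => μ.restrict (f^[n] ⁻¹' A j)) fun n => ?_
    rw [Function.iterate_succ, preimage_comp, ← Measure.restrict_map hf (hf.iterate n (hA j)), hμ]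
  choose ν hν using key
  have hp : ∀ k, Measurable fun z : ℕ → X => (z k, z (k + 1)) := fun k =>
    (measurable_pi_apply k).prodMk (measurable_pi_apply (k + 1))
  have hg : Measurable fun x => (f x, x) := hf.prodMk measurable_id
  have hmarg : ∀ j k, (ν j).map (fun z => z k) = μ.restrict (f^[k] ⁻¹' A j) := by
    intro j k
    have h1 := congrArg (Measure.map Prod.fst) (hν j k)
    rw [Measure.map_map measurable_fst (hp k), Measure.map_map measurable_fst hg] at h1
    refine h1.trans ?_
    change (μ.restrict (f^[k + 1] ⁻¹' A j)).map f = _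
    rw [Function.iterate_succ, preimage_comp, ← Measure.restrict_map hf (hf.iterate k (hA j)), hμ]
  refine ⟨Measure.sum ν, fun k => ?_, fun k => ?_⟩
  · rw [Measure.map_sum (measurable_pi_apply k).aemeasurable, preimage_iUnion,
      Measure.restrict_iUnion _ fun j => hf.iterate k (hA j)]
    · simp only [hmarg]
    · exact fun i j hij => (hdisj hij).preimage _
  · rw [Measure.ae_sum_iff]
    intro j
    have hset : MeasurableSet {p : X × X | f p.2 = p.1} :=
      measurableSet_eq_fun (hf.comp measurable_snd) measurable_fst
    have h1 : ∀ᵐ p ∂(ν j).map (fun z => (z k, z (k + 1))), f p.2 = p.1 := by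
      rw [hν j k, ae_map_iff hg.aemeasurable hset]
      exact Eventually.of_forall fun x => rfl
    exact (ae_map_iff (hp k).aemeasurable hset).1 h1

/-! ### The natural measure on backward orbits -/

/-- Closed annuli that exhaust the punctured unit disk. -/
def exhaustionAnnulus (n : ℕ) : Set ℂ := {z | 1 / ((n : ℝ) + 2) ≤ ‖z‖ ∧ ‖z‖ ≤ exhaustionRadius n}

theorem isClosed_exhaustionAnnulus (n : ℕ) : IsClosed (exhaustionAnnulus n) :=
  (isClosed_le continuous_const continuous_norm).inter
    (isClosed_le continuous_norm continuous_const)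

theorem exhaustionAnnulus_subset (n : ℕ) : exhaustionAnnulus n ⊆ ball 0 1 \ {0} := by
  intro z hz
  refine ⟨by simpa using hz.2.trans_lt (exhaustionRadius_lt_one n), fun h => ?_⟩
  have h0 : ‖z‖ = 0 := by rw [h, norm_zero]
  have h1 := hz.1
  rw [h0] at h1
  have : (0 : ℝ) < 1 / (n + 2) := by positivity
  linarith

theorem exists_subset_closedBall {z : ℂ} (hz : ‖z‖ < 1) : ∃ n, ‖z‖ ≤ exhaustionRadius n := by
  obtain ⟨n, hn⟩ := (tendsto_exhaustionRadius.eventually_const_lt hz).exists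
  exact ⟨n, hn.le⟩

theorem iUnion_exhaustionAnnulus : ⋃ n, exhaustionAnnulus n = ball 0 1 \ {0} := by
  refine (iUnion_subset exhaustionAnnulus_subset).antisymm fun z hz => ?_
  have hz1 : ‖z‖ < 1 := by simpa using hz.1
  have hz0 : 0 < ‖z‖ := norm_pos_iff.2 hz.2
  have h1 : Tendsto (fun n : ℕ => (1 : ℝ) / (n + 2)) atTop (𝓝 0) := by
    have := tendsto_exhaustionRadius.const_sub 1
    simpa [exhaustionRadius] using this
  obtain ⟨n, hn1, hn2⟩ := ((h1.eventually_lt_const hz0).and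
    (tendsto_exhaustionRadius.eventually_const_lt hz1)).exists
  exact mem_iUnion.2 ⟨n, hn1.le, hn2.le⟩

namespace CenteredInnerFunction

variable (F : CenteredInnerFunction)

theorem not_exists_diskMap_eq_mul (hrot : ¬ F.IsRotation) :
    ¬ ∃ c : ℂ, ‖c‖ = 1 ∧ ∀ z ∈ ball (0 : ℂ) 1, F.diskMap z = c * z := by
  rintro ⟨c, hc, h⟩
  exact hrot ⟨c, hc, fun z hz => by rw [← F.diskMap_apply hz, h z hz]⟩

theorem diskMap_coord_succ (z : F.BackwardOrbit) (n : ℕ) : F.diskMap (z.1 (n + 1)) = z.1 n := by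
  rw [F.diskMap_apply (z.2.1 _), z.2.2.1]

theorem diskMap_iterate_coord (z : F.BackwardOrbit) (n m : ℕ) :
    F.diskMap^[m] (z.1 (n + m)) = z.1 n := by
  induction m with
  | zero => rfl
  | succ m ih => rw [Function.iterate_succ_apply, ← add_assoc, F.diskMap_coord_succ, ih]

theorem measurable_coord (k : ℕ) : Measurable fun z : F.BackwardOrbit => z.1 k :=
  (measurable_pi_apply k).comp measurable_subtype_coe

theorem diskMap_hat_coord (z : F.BackwardOrbit) (k : ℕ) :
    (F.hat z).1 k = F.diskMap (z.1 k) := (F.diskMap_apply (z.2.1 k)).symm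

theorem hat_coord_succ (z : F.BackwardOrbit) (k : ℕ) : (F.hat z).1 (k + 1) = z.1 k := z.2.2.1 k

theorem hat_symm_coord (z : F.BackwardOrbit) (k : ℕ) : (F.hat.symm z).1 k = z.1 (k + 1) := rfl

theorem measurable_hat : Measurable F.hat := by
  refine Measurable.subtype_mk (measurable_pi_lambda _ fun k => ?_)
  have h : Measurable fun z : F.BackwardOrbit => F.diskMap (z.1 k) :=
    F.isCenteredInnerMap_diskMap.measurable.comp (F.measurable_coord k)
  have heq : (fun z : F.BackwardOrbit => F (z.1 k)) = fun z => F.diskMap (z.1 k) :=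
    funext fun z => (F.diskMap_apply (z.2.1 k)).symm
  rw [heq]
  exact h

theorem measurable_hat_symm : Measurable F.hat.symm :=
  Measurable.subtype_mk (measurable_pi_lambda _ fun k => F.measurable_coord (k + 1))

theorem iterPreimage_eq (n : ℕ) (A : Set ℂ) :
    F.iterPreimage n A = F.diskMap^[n] ⁻¹' A ∩ ball 0 1 := by
  have h : ∀ n, ∀ z ∈ ball (0 : ℂ) 1, F^[n] z = F.diskMap^[n] z := by
    intro n
    induction n with
    | zero => exact fun z _ => rfl
    | succ n ih =>
      intro z hz
      rw [Function.iterate_succ_apply, Function.iterate_succ_apply, F.diskMap_apply hz,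
        ih _ (F.mapsTo hz)]
  ext z
  simp only [iterPreimage, mem_ofPred_eq, mem_inter_iff, mem_preimage]
  constructor
  · exact fun ⟨h1, h2⟩ => ⟨h n z h1 ▸ h2, h1⟩
  · exact fun ⟨h1, h2⟩ => ⟨h2, (h n z h2).symm ▸ h1⟩

theorem heightArea_iterPreimage (n : ℕ) {A : Set ℂ} (hA : MeasurableSet A) :
    heightArea (F.iterPreimage n A) = heightMeasure.map F.diskMap^[n] A := by
  have hm := F.isCenteredInnerMap_diskMap.measurable_iterate n
  rw [F.iterPreimage_eq, heightArea_eq ((hm hA).inter measurableSet_ball), Measure.map_apply hm hA]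
  refine measure_congr ?_
  filter_upwards [measure_ball_compl_potentialMeasure (pullbackDensity diskId)] with z hz
  exact propext ⟨fun h => h.1, fun h => ⟨h, hz⟩⟩

theorem tendsto_heightArea {A : Set ℂ} (hA : MeasurableSet A) :
    Tendsto (fun n => heightArea (F.iterPreimage n A)) atTop (𝓝 (invariantMeasure F.diskMap A)) := by
  simp only [F.heightArea_iterPreimage _ hA]
  exact F.isCenteredInnerMap_diskMap.tendsto_map_iterate hA

variable {F}

theorem defectMeasure_univ_ne_top (hF : F.FiniteLyapunovExponent) :
    defectMeasure F.diskMap univ ≠ ⊤ := by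
  rw [(F.defectMeasure_univ hF).1]
  exact ENNReal.ofReal_ne_top

theorem invariantMeasure_lt_top_of_closure_subset (hrot : ¬ F.IsRotation)
    (hF : F.FiniteLyapunovExponent) {A : Set ℂ} (hA : closure A ⊆ ball 0 1 \ {0}) :
    invariantMeasure F.diskMap A < ⊤ := by
  have hcomp : IsCompact (closure A) := by
    refine isCompact_of_isClosed_isBounded isClosed_closure ?_
    exact isBounded_ball.subset (hA.trans sdiff_subset)
  rcases (closure A).eq_empty_or_nonempty with h0 | hne
  · rw [(closure_empty_iff A).1 h0, measure_empty]
    exact ENNReal.zero_lt_top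
  obtain ⟨a, ha, hmin⟩ := hcomp.exists_isMinOn hne continuous_norm.continuousOn
  obtain ⟨b, hb, hmax⟩ := hcomp.exists_isMaxOn hne continuous_norm.continuousOn
  refine (measure_mono fun z hz => ?_).trans_lt
    (F.isCenteredInnerMap_diskMap.invariantMeasure_annulus_lt_top
      (F.not_exists_diskMap_eq_mul hrot) (defectMeasure_univ_ne_top hF)
      (norm_pos_iff.2 (hA ha).2) (norm_nonneg b) (by simpa using (hA hb).1))
  exact ⟨hmin (subset_closure hz), hmax (subset_closure hz)⟩

theorem invariantMeasure_exhaustionAnnulus (hrot : ¬ F.IsRotation)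
    (hF : F.FiniteLyapunovExponent) (n : ℕ) :
    invariantMeasure F.diskMap (exhaustionAnnulus n) < ⊤ :=
  invariantMeasure_lt_top_of_closure_subset hrot hF
    ((isClosed_exhaustionAnnulus n).closure_eq.symm ▸ exhaustionAnnulus_subset n)

/-- There is a measure on the space of backward orbits all of whose one-dimensional marginals are
the invariant measure. -/
theorem exists_measure_map_coord (hrot : ¬ F.IsRotation) (hF : F.FiniteLyapunovExponent) :
    ∃ ξ : Measure F.BackwardOrbit, ∀ k, ξ.map (fun z => z.1 k) = invariantMeasure F.diskMap := by
  set f := F.diskMap with hfdef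
  have hf := F.isCenteredInnerMap_diskMap
  set μ := invariantMeasure f with hμ
  have hinv : μ.map f = μ := hf.map_invariantMeasure
  have hmA : ∀ n, MeasurableSet (exhaustionAnnulus n) := fun n =>
    (isClosed_exhaustionAnnulus n).measurableSet
  obtain ⟨ν, hν1, hν2⟩ := exists_naturalExtension
    (fun h : Countable ℂ => not_countable_complex (countable_univ_iff.2 h)) hf.measurable hinv
    (MeasurableSet.disjointed hmA) (disjoint_disjointed exhaustionAnnulus)
    (fun j => ne_top_of_le_ne_top (invariantMeasure_exhaustionAnnulus hrot hF j).ne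
      (measure_mono (disjointed_subset exhaustionAnnulus j)))
  rw [iUnion_disjointed, iUnion_exhaustionAnnulus] at hν1
  -- With invariance, this makes the restriction in each marginal vacuous and confines ν to genuine
  -- nonzero backward orbits.
  have hfull : ∀ᵐ z ∂μ, z ∈ ball (0 : ℂ) 1 \ {0} := by
    have h1 : ∀ᵐ z ∂μ, z ∈ ball (0 : ℂ) 1 := hf.invariantMeasure_compl_ball
    have h2 : ∀ᵐ z ∂μ, z ≠ 0 := by
      rw [ae_iff]
      simpa using hf.invariantMeasure_singleton_zero
    filter_upwards [h1, h2] with z h1 h2 using ⟨h1, h2⟩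
  have hiter : ∀ k, μ.map f^[k] = μ := by
    intro k
    induction k with
    | zero => simp
    | succ k ih =>
      rw [Function.iterate_succ, ← Measure.map_map (hf.measurable_iterate k) hf.measurable, hinv, ih]
  have hmarg : ∀ k, ν.map (fun z => z k) = μ := by
    intro k
    rw [hν1 k, Measure.restrict_eq_self_of_ae_mem]
    rw [← hiter k] at hfull
    exact ae_of_ae_map (hf.measurable_iterate k).aemeasurable hfull
  set S : Set (ℕ → ℂ) :=
    {z | (∀ n, z n ∈ ball (0 : ℂ) 1) ∧ (∀ n, F (z (n + 1)) = z n) ∧ z ≠ 0} with hS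
  have hSeq : S = (⋂ n, {z | z n ∈ ball (0 : ℂ) 1}) ∩ (⋂ n, {z | f (z (n + 1)) = z n}) ∩ {0}ᶜ := by
    ext z
    simp only [hS, mem_ofPred_eq, mem_inter_iff, mem_iInter, mem_compl_iff, mem_singleton_iff,
      and_assoc]
    refine and_congr_right fun h => and_congr_left fun _ => forall_congr' fun n => ?_
    rw [hfdef, F.diskMap_apply (h _)]
  have hSm : MeasurableSet S := by
    rw [hSeq]
    refine ((MeasurableSet.iInter fun n => measurable_pi_apply n measurableSet_ball).inter
      (MeasurableSet.iInter fun n => measurableSet_eq_fun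
        (hf.measurable.comp (measurable_pi_apply (n + 1))) (measurable_pi_apply n))).inter
      (measurableSet_singleton 0).compl
  have hSae : ∀ᵐ z ∂ν, z ∈ S := by
    have h1 : ∀ᵐ z ∂ν, ∀ n, z n ∈ ball (0 : ℂ) 1 \ {0} := by
      rw [ae_all_iff]
      intro n
      rw [← hmarg n] at hfull
      exact ae_of_ae_map (measurable_pi_apply n).aemeasurable hfull
    filter_upwards [h1, ae_all_iff.2 hν2] with z hz1 hz2
    refine ⟨fun n => (hz1 n).1, fun n => ?_, fun h => (hz1 0).2 (by rw [h]; rfl)⟩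
    rw [← hz2 n, F.diskMap_apply (hz1 _).1]
  refine ⟨ν.comap Subtype.val, fun k => ?_⟩
  have h1 : (ν.comap (Subtype.val : F.BackwardOrbit → ℕ → ℂ)).map Subtype.val = ν := by
    have h2 : (ν.comap (Subtype.val : S → ℕ → ℂ)).map Subtype.val = ν := by
      rw [map_comap_subtype_coe hSm, Measure.restrict_eq_self_of_ae_mem hSae]
    exact h2
  rw [← hmarg k]
  conv_rhs => rw [← h1]
  rw [Measure.map_map (measurable_pi_apply k) measurable_subtype_coe]
  rfl

/-- A measure on the space of backward orbits is determined by the masses of the cylinders over the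
sets compactly contained in the disk. -/
theorem ext_of_coord (hrot : ¬ F.IsRotation) (hF : F.FiniteLyapunovExponent)
    {ξ₁ ξ₂ : Measure F.BackwardOrbit}
    (h₁ : ∀ k A, MeasurableSet A → closure A ⊆ ball 0 1 →
      ξ₁ {z | z.1 k ∈ A} = invariantMeasure F.diskMap A)
    (h₂ : ∀ k A, MeasurableSet A → closure A ⊆ ball 0 1 →
      ξ₂ {z | z.1 k ∈ A} = invariantMeasure F.diskMap A) : ξ₁ = ξ₂ := by
  set S : Set (Set F.BackwardOrbit) :=
    {s | ∃ k A, MeasurableSet A ∧ closure A ⊆ ball (0 : ℂ) 1 ∧ s = {z | z.1 k ∈ A}} with hS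
  have heq : ∀ s ∈ S, ξ₁ s = ξ₂ s := by
    rintro s ⟨k, A, hA, hAc, rfl⟩
    rw [h₁ k A hA hAc, h₂ k A hA hAc]
  -- Cylinders form a π-system: an earlier coordinate determines the later ones, so both conditions
  -- can be imposed on z_l, as z_l ∈ F^{-(l-k)}(A) ∩ B.
  have hinter_le : ∀ (k l : ℕ) (A B : Set ℂ), MeasurableSet A → MeasurableSet B →
      closure B ⊆ ball 0 1 → k ≤ l →
      ({z : F.BackwardOrbit | z.1 k ∈ A} ∩ {z | z.1 l ∈ B}) ∈ S := by
    intro k l A B hA hB hBc hkl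
    obtain ⟨m, rfl⟩ := Nat.exists_eq_add_of_le hkl
    refine ⟨k + m, F.diskMap^[m] ⁻¹' A ∩ B,
      (F.isCenteredInnerMap_diskMap.measurable_iterate m hA).inter hB,
      (closure_mono inter_subset_right).trans hBc, ?_⟩
    ext z
    simp only [mem_inter_iff, mem_ofPred_eq, mem_preimage, F.diskMap_iterate_coord]
  have hinter : ∀ s ∈ S, ∀ t ∈ S, s ∩ t ∈ S := by
    rintro s ⟨k, A, hA, hAc, rfl⟩ t ⟨l, B, hB, hBc, rfl⟩
    rcases le_total k l with h | h
    · exact hinter_le k l A B hA hB hBc h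
    · rw [inter_comm]
      exact hinter_le l k B A hB hA hAc h
  -- A countable cover by cylinders of finite mass. All coordinates k are needed, since z 0 may be 0
  -- for a nonzero orbit.
  set T : Set (Set F.BackwardOrbit) :=
    range fun p : ℕ × ℕ => {z | z.1 p.1 ∈ exhaustionAnnulus p.2} with hT
  have hTc : ∀ n, closure (exhaustionAnnulus n) ⊆ ball 0 1 := fun n => by
    rw [(isClosed_exhaustionAnnulus n).closure_eq]
    exact (exhaustionAnnulus_subset n).trans sdiff_subset
  have hTS : T ⊆ S := by
    rintro t ⟨⟨k, n⟩, rfl⟩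
    exact ⟨k, _, (isClosed_exhaustionAnnulus n).measurableSet, hTc n, rfl⟩
  refine Measure.ext_of_generateFrom_of_cover (S := S) (T := T) ?_ (countable_range _)
    (fun s hs t ht _ => hinter s hs t ht) ?_ ?_ (fun t ht s hs => heq _ (hinter s hs t (hTS ht)))
    (fun t ht => heq t (hTS ht))
  · refine le_antisymm ?_ (MeasurableSpace.generateFrom_le ?_)
    · let _ : MeasurableSpace F.BackwardOrbit := MeasurableSpace.generateFrom S
      have hmeas : Measurable fun z : F.BackwardOrbit => z.1 := by
        refine measurable_pi_lambda _ fun k => ?_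
        intro s hs
        have hunion : (fun z : F.BackwardOrbit => z.1 k) ⁻¹' s =
            ⋃ n, {z | z.1 k ∈ s ∩ closedBall 0 (exhaustionRadius n)} := by
          ext z
          simp only [mem_preimage, mem_iUnion, mem_ofPred_eq, mem_inter_iff, mem_closedBall_zero_iff,
            exists_and_left]
          exact ⟨fun h => ⟨h, exists_subset_closedBall (by simpa using z.2.1 k)⟩, fun h => h.1⟩
        rw [hunion]
        refine MeasurableSet.iUnion fun n => MeasurableSpace.measurableSet_generateFrom ?_
        refine ⟨k, _, hs.inter measurableSet_closedBall, ?_, rfl⟩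
        refine (closure_mono inter_subset_right).trans ?_
        rw [isClosed_closedBall.closure_eq]
        exact closedBall_subset_ball (exhaustionRadius_lt_one n)
      exact hmeas.comap_le
    · rintro s ⟨k, A, hA, -, rfl⟩
      exact F.measurable_coord k hA
  · refine eq_univ_of_forall fun z => ?_
    obtain ⟨k, hk⟩ : ∃ k, z.1 k ≠ 0 := by
      by_contra! hcon
      exact z.2.2.2 (funext hcon)
    have hz : z.1 k ∈ ⋃ n, exhaustionAnnulus n := by
      rw [iUnion_exhaustionAnnulus]
      exact ⟨z.2.1 k, hk⟩
    obtain ⟨n, hn⟩ := mem_iUnion.1 hz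
    exact ⟨_, ⟨(k, n), rfl⟩, hn⟩
  · rintro t ⟨⟨k, n⟩, rfl⟩
    rw [h₁ k _ (isClosed_exhaustionAnnulus n).measurableSet (hTc n)]
    exact (invariantMeasure_exhaustionAnnulus hrot hF n).ne

/-- The limit formula fixes the case k = 0, and invariance under the shift carries it to every
coordinate. -/
theorem IsNaturalMeasure.apply_coord {ξ : Measure F.BackwardOrbit} (hξ : F.IsNaturalMeasure ξ)
    (k : ℕ) {A : Set ℂ} (hA : MeasurableSet A) (hAc : closure A ⊆ ball 0 1) :
    ξ {z | z.1 k ∈ A} = invariantMeasure F.diskMap A := by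
  induction k with
  | zero => exact tendsto_nhds_unique (hξ.tendsto A hA hAc) (F.tendsto_heightArea hA)
  | succ k ih =>
    have hm : MeasurableSet {z : F.BackwardOrbit | z.1 (k + 1) ∈ A} := F.measurable_coord (k + 1) hA
    rw [← ih, ← hξ.invariant.measure_preimage hm.nullMeasurableSet]
    congr 1
    ext z
    simp only [mem_preimage, mem_ofPred_eq, F.hat_coord_succ]

theorem isNaturalMeasure_of_map_coord (hrot : ¬ F.IsRotation) (hF : F.FiniteLyapunovExponent)
    {ξ : Measure F.BackwardOrbit}
    (hξ : ∀ k, ξ.map (fun z => z.1 k) = invariantMeasure F.diskMap) : F.IsNaturalMeasure ξ where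
  invariant := by
    refine ⟨F.measurable_hat, ext_of_coord hrot hF (fun k A hA _ => ?_) (fun k A hA _ => ?_)⟩
    · have hf := F.isCenteredInnerMap_diskMap
      have hm : MeasurableSet {z : F.BackwardOrbit | z.1 k ∈ A} := F.measurable_coord k hA
      rw [Measure.map_apply F.measurable_hat hm]
      have : F.hat ⁻¹' {z | z.1 k ∈ A} = (fun z : F.BackwardOrbit => z.1 k) ⁻¹' (F.diskMap ⁻¹' A) := by
        ext z
        simp only [mem_preimage, mem_ofPred_eq, F.diskMap_hat_coord]
      rw [this, ← Measure.map_apply (F.measurable_coord k) (hf.measurable hA), hξ,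
        ← Measure.map_apply hf.measurable hA, hf.map_invariantMeasure]
    · rw [← hξ k, Measure.map_apply (F.measurable_coord k) hA]
      rfl
  tendsto A hA _ := by
    have h : ξ (F.cylinder A) = invariantMeasure F.diskMap A := by
      rw [← hξ 0, Measure.map_apply (F.measurable_coord 0) hA]
      rfl
    rw [h]
    exact F.tendsto_heightArea hA

end CenteredInnerFunction

/-! ### The lamination and its fundamental domain -/

namespace CenteredInnerFunction

variable {F : CenteredInnerFunction}

theorem hat_pow_coord (z : F.BackwardOrbit) (n : ℕ) :
    ((F.hat ^ n) z).1 0 = F.diskMap^[n] (z.1 0) := by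
  induction n generalizing z with
  | zero => rfl
  | succ n ih =>
    rw [pow_succ, Equiv.Perm.mul_apply, ih, F.diskMap_hat_coord, Function.iterate_succ_apply]

theorem hat_inv_pow_coord (z : F.BackwardOrbit) (n : ℕ) : ((F.hat⁻¹ ^ n) z).1 0 = z.1 n := by
  induction n generalizing z with
  | zero => rfl
  | succ n ih =>
    rw [pow_succ, Equiv.Perm.mul_apply, ih]
    exact F.hat_symm_coord z n

theorem norm_hat_zpow_coord_antitone (z : F.BackwardOrbit) :
    Antitone fun k : ℤ => ‖((F.hat ^ k) z).1 0‖ := by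
  refine antitone_int_of_succ_le fun k => ?_
  rw [add_comm, zpow_one_add, Equiv.Perm.mul_apply, F.diskMap_hat_coord]
  exact F.isCenteredInnerMap_diskMap.norm_le_norm _

theorem exists_norm_hat_zpow_coord_lt (hrot : ¬ F.IsRotation) (z : F.BackwardOrbit) {r : ℝ}
    (hr : 0 < r) : ∃ k : ℤ, ‖((F.hat ^ k) z).1 0‖ < r := by
  obtain ⟨N, hN⟩ := F.isCenteredInnerMap_diskMap.exists_norm_iterate_lt
    (F.not_exists_diskMap_eq_mul hrot) (norm_nonneg (z.1 0)) (by simpa using z.2.1 0) hr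
  refine ⟨N, ?_⟩
  rw [zpow_natCast, hat_pow_coord]
  exact hN _ le_rfl

/-- Pasts leave every compact disk: starting inside radius r, N steps would bring the orbit closer
to 0 than its nonzero coordinate z_m, a contradiction when the start is z_{m+N}. -/
theorem exists_le_norm_hat_zpow_coord (hrot : ¬ F.IsRotation) (z : F.BackwardOrbit) {r : ℝ}
    (hr : 0 < r) (hr1 : r < 1) : ∃ k : ℤ, r ≤ ‖((F.hat ^ k) z).1 0‖ := by
  obtain ⟨m, hm⟩ : ∃ m, z.1 m ≠ 0 := by
    by_contra! hcon
    exact z.2.2.2 (funext hcon)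
  obtain ⟨N, hN⟩ := F.isCenteredInnerMap_diskMap.exists_norm_iterate_lt
    (F.not_exists_diskMap_eq_mul hrot) hr.le hr1 (norm_pos_iff.2 hm)
  refine ⟨-((m + N : ℕ) : ℤ), ?_⟩
  rw [zpow_neg, zpow_natCast, ← inv_pow, hat_inv_pow_coord]
  by_contra! hlt
  have h := hN _ hlt.le
  rw [F.diskMap_iterate_coord] at h
  exact lt_irrefl _ h

/-- The set of backward orbits that enter the disk of radius `r` at time zero; it is a fundamental
domain for the action of `F.hat`. -/
def entrySet (F : CenteredInnerFunction) (r : ℝ) : Set F.BackwardOrbit :=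
  {z | z.1 1 ∈ F.diskMap ⁻¹' ball 0 r \ ball 0 r}

theorem measurableSet_preimage_ball_sdiff (F : CenteredInnerFunction) (r : ℝ) :
    MeasurableSet (F.diskMap ⁻¹' ball 0 r \ ball 0 r) :=
  (F.isCenteredInnerMap_diskMap.measurable measurableSet_ball).diff measurableSet_ball

theorem measurableSet_entrySet (F : CenteredInnerFunction) (r : ℝ) : MeasurableSet (F.entrySet r) :=
  F.measurable_coord 1 (F.measurableSet_preimage_ball_sdiff r)

theorem hat_zpow_mem_entrySet (z : F.BackwardOrbit) (k : ℤ) (r : ℝ) :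
    (F.hat ^ k) z ∈ F.entrySet r ↔
      ‖((F.hat ^ k) z).1 0‖ < r ∧ r ≤ ‖((F.hat ^ (k - 1)) z).1 0‖ := by
  have h : ((F.hat ^ k) z).1 1 = ((F.hat ^ (k - 1)) z).1 0 := by
    conv_lhs => rw [show k = 1 + (k - 1) by ring, zpow_one_add, Equiv.Perm.mul_apply]
    exact F.hat_coord_succ _ 0
  have h' := F.diskMap_coord_succ ((F.hat ^ k) z) 0
  rw [zero_add] at h'
  change _ ∈ F.diskMap ⁻¹' ball 0 r \ ball 0 r ↔ _
  rw [Set.mem_sdiff, mem_preimage, h', h, mem_ball_zero_iff, mem_ball_zero_iff, not_lt]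

/-- The moduli decrease along the two-sided orbit, from above r to below r. The entry time is the
least index with modulus below r. -/
theorem existsUnique_hat_zpow_mem_entrySet (hrot : ¬ F.IsRotation) (z : F.BackwardOrbit) {r : ℝ}
    (hr : 0 < r) (hr1 : r < 1) : ∃! k : ℤ, (F.hat ^ k) z ∈ F.entrySet r := by
  have hanti := norm_hat_zpow_coord_antitone z
  obtain ⟨b, hb⟩ := exists_le_norm_hat_zpow_coord hrot z hr hr1
  obtain ⟨k, hk, hmin⟩ := Int.exists_least_of_bdd (P := fun k => ‖((F.hat ^ k) z).1 0‖ < r)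
    ⟨b, fun k hk => by
      by_contra! hlt
      exact absurd (hb.trans (hanti hlt.le)) (not_le.2 hk)⟩ (exists_norm_hat_zpow_coord_lt hrot z hr)
  have hle : ∀ k l : ℤ, (F.hat ^ k) z ∈ F.entrySet r → (F.hat ^ l) z ∈ F.entrySet r → l ≤ k := by
    intro k l hk hl
    rw [hat_zpow_mem_entrySet] at hk hl
    by_contra! hlt
    exact absurd (hl.2.trans (hanti (show k ≤ l - 1 by lia))) (not_le.2 hk.1)
  have hmem : (F.hat ^ k) z ∈ F.entrySet r := by
    rw [hat_zpow_mem_entrySet]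
    refine ⟨hk, ?_⟩
    by_contra! hlt
    have := hmin _ hlt
    lia
  exact ⟨k, hmem, fun l hl => le_antisymm (hle k l hmem hl) (hle l k hl hmem)⟩

theorem proj_eq_iff (z w : F.BackwardOrbit) : F.proj z = F.proj w ↔ ∃ k : ℤ, (F.hat ^ k) w = z := by
  rw [proj, proj, Quotient.eq, MulAction.orbitRel_apply, MulAction.mem_orbit_iff]
  constructor
  · rintro ⟨⟨g, hg⟩, h⟩
    obtain ⟨k, rfl⟩ := Subgroup.mem_zpowers_iff.1 hg
    exact ⟨k, h⟩
  · rintro ⟨k, h⟩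
    exact ⟨⟨F.hat ^ k, Subgroup.zpow_mem_zpowers _ _⟩, h⟩

theorem proj_hat_zpow (z : F.BackwardOrbit) (k : ℤ) : F.proj ((F.hat ^ k) z) = F.proj z :=
  (proj_eq_iff _ _).2 ⟨k, rfl⟩

theorem measurable_proj (F : CenteredInnerFunction) : Measurable F.proj :=
  measurable_quotient_mk''

theorem injOn_proj_entrySet (hrot : ¬ F.IsRotation) {r : ℝ} (hr : 0 < r) (hr1 : r < 1) :
    InjOn F.proj (F.entrySet r) := by
  intro z hz w hw h
  obtain ⟨k, rfl⟩ := (proj_eq_iff z w).1 h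
  have h0 : k = 0 := (existsUnique_hat_zpow_mem_entrySet hrot w hr hr1).unique hz
    (by simpa using hw)
  simp [h0]

theorem preimage_proj_image (E : Set F.BackwardOrbit) :
    F.proj ⁻¹' (F.proj '' E) = ⋃ k : ℤ, (F.hat ^ k) ⁻¹' E := by
  ext z
  simp only [mem_preimage, mem_image, mem_iUnion]
  constructor
  · rintro ⟨w, hw, h⟩
    obtain ⟨k, rfl⟩ := (proj_eq_iff w z).1 h
    exact ⟨k, hw⟩
  · rintro ⟨k, hk⟩
    exact ⟨_, hk, proj_hat_zpow z k⟩

theorem measurePreserving_hat_zpow {ξ : Measure F.BackwardOrbit} (h : MeasurePreserving F.hat ξ ξ)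
    (k : ℤ) : MeasurePreserving (F.hat ^ k : Equiv.Perm F.BackwardOrbit) ξ ξ := by
  have hinv : MeasurePreserving (F.hat⁻¹ : Equiv.Perm F.BackwardOrbit) ξ ξ :=
    MeasurePreserving.symm (⟨F.hat, F.measurable_hat, F.measurable_hat_symm⟩ :
      F.BackwardOrbit ≃ᵐ F.BackwardOrbit) h
  induction k with
  | zero => exact MeasurePreserving.id ξ
  | succ k ih =>
    rw [zpow_add_one]
    exact ih.comp h
  | pred k ih =>
    rw [zpow_sub_one]
    exact ih.comp hinv

/-- The measure on the lamination induced by `ξ`, realized on a fundamental domain. -/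
noncomputable def laminationMeasure (ξ : Measure F.BackwardOrbit) (r : ℝ) : Measure F.Lamination :=
  (ξ.restrict (F.entrySet r)).map F.proj

/-- Unfolding: the part of the fundamental domain D over the image of E is the disjoint union of the
sets D ∩ F̂^{-k}E. By invariance these have the masses of E ∩ F̂^k D, which partition E. -/
theorem isInducedMeasure_laminationMeasure (hrot : ¬ F.IsRotation) {r : ℝ} (hr : 0 < r)
    (hr1 : r < 1) {ξ : Measure F.BackwardOrbit} (hξ : MeasurePreserving F.hat ξ ξ) :
    F.IsInducedMeasure ξ (laminationMeasure ξ r) := by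
  intro E hE hinj
  have hpre : ∀ k : ℤ, MeasurableSet ((F.hat ^ k) ⁻¹' E) := fun k =>
    (measurePreserving_hat_zpow hξ k).measurable hE
  have hD := F.measurableSet_entrySet r
  have huniq := fun z => existsUnique_hat_zpow_mem_entrySet hrot z hr hr1
  have hpm : MeasurableSet (F.proj ⁻¹' (F.proj '' E)) := by
    rw [preimage_proj_image]
    exact MeasurableSet.iUnion hpre
  -- In the quotient σ-algebra, measurability of a set means by definition measurability of its
  -- preimage.
  have him : MeasurableSet (F.proj '' E) := hpm
  rw [laminationMeasure, Measure.map_apply F.measurable_proj him, Measure.restrict_apply hpm,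
    preimage_proj_image, iUnion_inter, measure_iUnion]
  · have hk : ∀ k : ℤ, ξ ((F.hat ^ k) ⁻¹' E ∩ F.entrySet r) =
        ξ ((F.hat ^ (-k)) ⁻¹' F.entrySet r ∩ E) := by
      intro k
      have hm : MeasurableSet ((F.hat ^ (-k)) ⁻¹' F.entrySet r ∩ E) :=
        ((measurePreserving_hat_zpow hξ (-k)).measurable hD).inter hE
      rw [← (measurePreserving_hat_zpow hξ k).measure_preimage hm.nullMeasurableSet]
      congr 1
      ext z
      simp only [mem_inter_iff, mem_preimage, ← Equiv.Perm.mul_apply, ← zpow_add, neg_add_cancel,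
        zpow_zero, Equiv.Perm.one_apply]
      exact and_comm
    simp_rw [hk]
    rw [← measure_iUnion]
    · congr 1
      ext z
      simp only [mem_iUnion, mem_inter_iff, mem_preimage, exists_and_right, and_iff_right_iff_imp]
      intro _
      obtain ⟨k, hk, -⟩ := huniq z
      exact ⟨-k, by rwa [neg_neg]⟩
    · intro k l hkl
      refine disjoint_left.2 fun z hzk hzl => hkl ?_
      exact neg_injective ((huniq z).unique hzk.1 hzl.1)
    · exact fun k => ((measurePreserving_hat_zpow hξ (-k)).measurable hD).inter hE
  · intro k l hkl
    refine disjoint_left.2 fun z hzk hzl => hkl ?_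
    have h := hinj hzk.1 hzl.1 (by rw [proj_hat_zpow, proj_hat_zpow])
    obtain ⟨j, hj, -⟩ := huniq ((F.hat ^ k) z)
    have hj' := hj
    rw [h] at hj'
    simp only [← Equiv.Perm.mul_apply, ← zpow_add] at hj hj'
    exact add_left_cancel ((huniq z).unique hj hj')
  · exact fun k => (hpre k).inter hD

/-- Every measurable set of the lamination is the injective image of a measurable part of the
fundamental domain. -/
theorem IsInducedMeasure.unique (hrot : ¬ F.IsRotation) {ξ : Measure F.BackwardOrbit}
    {ν₁ ν₂ : Measure F.Lamination} (h₁ : F.IsInducedMeasure ξ ν₁) (h₂ : F.IsInducedMeasure ξ ν₂) :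
    ν₁ = ν₂ := by
  have hr : (0 : ℝ) < 1 / 2 := by norm_num
  have hr1 : (1 / 2 : ℝ) < 1 := by norm_num
  ext s hs
  have hE := (F.measurableSet_entrySet (1 / 2)).inter (F.measurable_proj hs)
  have hinj := (injOn_proj_entrySet hrot hr hr1).mono
    (inter_subset_left (s := F.entrySet (1 / 2)) (t := F.proj ⁻¹' s))
  have him : F.proj '' (F.entrySet (1 / 2) ∩ F.proj ⁻¹' s) = s := by
    rw [image_inter_preimage, inter_eq_right]
    intro x _
    obtain ⟨z, rfl⟩ := Quotient.mk_surjective x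
    obtain ⟨k, hk, -⟩ := existsUnique_hat_zpow_mem_entrySet hrot z hr hr1
    exact ⟨_, hk, proj_hat_zpow z k⟩
  rw [← him, h₁ _ hE hinj, h₂ _ hE hinj]

theorem laminationMeasure_univ (hrot : ¬ F.IsRotation) (hF : F.FiniteLyapunovExponent) {r : ℝ}
    (hr : 0 < r) (hr1 : r < 1) {ξ : Measure F.BackwardOrbit}
    (hξ : ξ.map (fun z => z.1 1) = invariantMeasure F.diskMap) :
    laminationMeasure ξ r univ = ENNReal.ofReal F.lyapunovExponent := by
  rw [laminationMeasure, Measure.map_apply F.measurable_proj MeasurableSet.univ, preimage_univ,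
    Measure.restrict_apply_univ, ← (F.defectMeasure_univ hF).1,
    ← F.isCenteredInnerMap_diskMap.invariantMeasure_preimage_ball_sdiff
      (F.not_exists_diskMap_eq_mul hrot) (defectMeasure_univ_ne_top hF) hr hr1, ← hξ,
    Measure.map_apply (F.measurable_coord 1) (F.measurableSet_preimage_ball_sdiff r)]
  rfl

end CenteredInnerFunction

/-- The natural measure `ξ` on the space of backward orbits exists and is unique, it is finite on
cylinders over sets compactly contained in the punctured disk, it induces a unique measure `ν` on
the lamination, and the total mass of `ν` is finite and equal to the Lyapunov exponent. -/
theorem mainTheorem7 (F : CenteredInnerFunction) (hrot : ¬ F.IsRotation)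
    (hF : F.FiniteLyapunovExponent) :
    ∃ ξ : MeasureTheory.Measure F.BackwardOrbit,
      (F.IsNaturalMeasure ξ ∧ ∀ ξ', F.IsNaturalMeasure ξ' → ξ' = ξ) ∧
      (∀ A : Set ℂ, MeasurableSet A → closure A ⊆ Metric.ball 0 1 \ {0} →
        ξ (F.cylinder A) < ⊤) ∧
      ∃ ν : MeasureTheory.Measure F.Lamination,
        (F.IsInducedMeasure ξ ν ∧ ∀ ν', F.IsInducedMeasure ξ ν' → ν' = ν) ∧
        ν Set.univ < ⊤ ∧ (ν Set.univ).toReal = F.lyapunovExponent := by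
  obtain ⟨ξ, hξ⟩ := CenteredInnerFunction.exists_measure_map_coord hrot hF
  have hnat := CenteredInnerFunction.isNaturalMeasure_of_map_coord hrot hF hξ
  -- Any radius in (0, 1) would do.
  have hr : (0 : ℝ) < 1 / 2 := by norm_num
  have hr1 : (1 / 2 : ℝ) < 1 := by norm_num
  have hind := CenteredInnerFunction.isInducedMeasure_laminationMeasure hrot hr hr1 hnat.invariant
  have huniv := CenteredInnerFunction.laminationMeasure_univ hrot hF hr hr1 (hξ 1)
  refine ⟨ξ, ⟨hnat, fun ξ' hξ' => ?_⟩, fun A hA hAc => ?_, _, ⟨hind, fun ν' hν' =>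
    hν'.unique hrot hind⟩, ?_, ?_⟩
  · exact CenteredInnerFunction.ext_of_coord hrot hF (fun k A hA hAc => hξ'.apply_coord k hA hAc)
      (fun k A hA hAc => hnat.apply_coord k hA hAc)
  · have h := hnat.apply_coord 0 hA (hAc.trans sdiff_subset)
    change ξ {z | z.1 0 ∈ A} < ⊤
    rw [h]
    exact CenteredInnerFunction.invariantMeasure_lt_top_of_closure_subset hrot hF hAc
  · rw [huniv]
    exact ENNReal.ofReal_lt_top
  · rw [huniv, ENNReal.toReal_ofReal (F.defectMeasure_univ hF).2]
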